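/- Conventions. Let $n\ge 1$ be an integer. An $\omega^n$-word over a finite alphabet $\Sigma$ is a sequence $(x(\beta))_{\beta<\omega^n}$ of letters of $\Sigma$. An ordinal Büchi automaton over $\Sigma$ consists of a finite set $Q$ of states, an initial state $q_0\in Q$, a relation $\Delta\subseteq Q\times\Sigma\times Q$ for successor steps, a relation $\gamma\subseteq P(Q)\times Q$ for limit steps, and a set $F\subseteq Q$ of accepting states. It accepts the $\omega^n$-word $\sigma$ if there is a sequence $(x(\beta))_{\beta\le\omega^n}$ of states with $x(0)=q_0$, with $(x(i),\sigma(i),x(i+1))\in\Delta$ for all $i<\omega^n$, with $(\{q\in Q : q=x(\nu)\text{ for cofinally many }\nu<i\},\,x(i))\in\gamma$ for all limit ordinals $i\le\omega^n$, and with $x(\omega^n)\in F$. A set of $\omega^n$-words over $\Sigma$ is a regular $\omega^n$-language if it is the set of $\omega^n$-words accepted by such an automaton. Tuples of $\omega^n$-words are identified with $\omega^n$-words over the product alphabet. An ordinal $\alpha$ is regarded as the structure $(\alpha,<)$. It is injectively $\omega^n$-automatic if $(\alpha,<)$ is isomorphic to $(L,R)$ for some regular $\omega^n$-language $L$ over some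 finite alphabet $\Sigma$ and some relation $R\subseteq L\times L$ that is regular as an $\omega^n$-language over $\Sigma\times\Sigma$. A finite $\omega^n$-word is an $\omega^n$-word over a finite alphabet containing a special letter $\diamondsuit$ all but finitely many of whose letters are $\diamondsuit$. The ordinal $\alpha$ is finite-word $\omega^n$-automatic if $L$ and $R$ can be chosen so that, moreover, $\Sigma$ contains a letter $\diamondsuit$ and all words of $L$ are finite $\omega^n$-words. Proposition. Let $n\ge 1$ be an integer. (1) Every countable ordinal that is injectively $\omega^n$-automatic is finite-word $\omega^n$-automatic. (2) The words of every countable regular $\omega^n$-language $L\subseteq\Sigma^{\omega^n}$ can be represented by finite $\omega^n$-words: there are a finite alphabet $\Gamma$ with a letter $\diamondsuit\in\Gamma$ and an injective map $f$ from $L$ to the set of finite $\omega^n$-words over $\Gamma$ such that $f(L)$ is a regular $\omega^n$-language over $\Gamma$ and $\{(w,f(w)) : w\in L\}$ is a regular $\omega^n$-language over $\Sigma\times\Gamma$. -/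

import Mathlib

open Ordinal

universe u v

namespace OrdAut

/-- Words of length `α` over the alphabet `A`: sequences of letters indexed by the ordinals
below `α`. -/
abbrev Word (α : Ordinal.{0}) (A : Type) : Type 1 := Set.Iio α → A

/-- Ordinal Büchi automata with alphabet `A` and set of states `Q`. -/
structure Automaton (A Q : Type) where
  /-- the initial state -/
  init : Q
  /-- transitions for successor steps -/
  step : Set (Q × A × Q)
  /-- transitions for limit steps -/
  limit : Set (Set Q × Q)
  /-- accepting states -/
  accept : Set Q

/-- The set of states that occur cofinally often in `x` before `i`. -/
def cofinalStates {Q : Type} (x : Ordinal.{0} → Q) (i : Ordinal.{0}) : Set Q :=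
  {q | ∀ μ < i, ∃ ν < i, μ < ν ∧ x ν = q}

/-- `x` is a run of `M` on the word `w` of length `α`. Only the values of `x` at the ordinals
`≤ α` matter, so `x` stands for a sequence of states of length `α + 1`. -/
structure Automaton.IsRun {A Q : Type} (M : Automaton A Q) {α : Ordinal.{0}} (w : Word α A)
    (x : Ordinal.{0} → Q) : Prop where
  zero : x 0 = M.init
  succ : ∀ i : Set.Iio α, (x i, w i, x (Order.succ (i : Ordinal.{0}))) ∈ M.step
  lim : ∀ i ≤ α, Order.IsSuccLimit i → (cofinalStates x i, x i) ∈ M.limit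

/-- The language of words of length `α` accepted by `M`. -/
def Automaton.language {A Q : Type} (M : Automaton A Q) (α : Ordinal.{0}) : Set (Word α A) :=
  {w | ∃ x : Ordinal.{0} → Q, M.IsRun w x ∧ x α ∈ M.accept}

/-- Regular languages of words of length `α`: those accepted by a finite automaton. -/
def IsRegular {α : Ordinal.{0}} {A : Type} (L : Set (Word α A)) : Prop :=
  ∃ (Q : Type) (_ : Finite Q) (M : Automaton A Q), M.language α = L

/-- A tuple of words, read as one word over the alphabet of tuples of letters. -/
def tupleWord {α : Ordinal.{0}} {A : Type} {m : ℕ} (w : Fin m → Word α A) :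
    Word α (Fin m → A) :=
  fun β j => w j β

/-- A pair of words, read as one word over the product alphabet. -/
def pairWord {α : Ordinal.{0}} {A B : Type} (w : Word α A) (z : Word α B) : Word α (A × B) :=
  fun β => (w β, z β)

/-- Finite words of length `α` with respect to the letter `d` (written `◇` in the literature):
all but finitely many letters are equal to `d`. -/
def IsFiniteWord {α : Ordinal.{0}} {A : Type} (d : A) (w : Word α A) : Prop :=
  {β | w β ≠ d}.Finite

/-- Relational structures with finitely many relations of finite arity on the domain `D`. -/
structure RelStructure (D : Type u) where
  /-- the number of relations -/
  num : ℕ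
  /-- the arities -/
  arity : Fin num → ℕ
  /-- the relations -/
  rel : (i : Fin num) → Set (Fin (arity i) → D)

/-- The data `(L, (R i)ᵢ, h)` is an injective `α`-automatic presentation of the structure `S`,
over the alphabet `A`: the domain `L` and the relations `R i` on `L` are regular, and `h` is
an isomorphism from `(L, (R i)ᵢ)` onto `S`. -/
structure IsInjectivePresentation {D : Type u} (S : RelStructure D) (α : Ordinal.{0}) (A : Type)
    (L : Set (Word α A)) (R : (i : Fin S.num) → Set (Word α (Fin (S.arity i) → A)))
    (h : L ≃ D) : Prop where
  regular_domain : IsRegular L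
  regular_rel : ∀ i, IsRegular (R i)
  rel_on : ∀ i, ∀ w ∈ R i, ∃ y : Fin (S.arity i) → L, w = tupleWord fun j => (y j : Word α A)
  map_rel : ∀ i, ∀ y : Fin (S.arity i) → L,
    (tupleWord fun j => (y j : Word α A)) ∈ R i ↔ (fun j => h (y j)) ∈ S.rel i

/-- `S` has an injective `α`-automatic presentation. -/
def IsInjectivelyAutomatic {D : Type u} (α : Ordinal.{0}) (S : RelStructure D) : Prop :=
  ∃ (A : Type) (_ : Finite A) (L : Set (Word α A))
    (R : (i : Fin S.num) → Set (Word α (Fin (S.arity i) → A))) (h : L ≃ D),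
    IsInjectivePresentation S α A L R h

/-- `S` has an injective `α`-automatic presentation whose elements are finite words of
length `α`, over an alphabet with a distinguished letter `d`. -/
def IsFiniteWordAutomatic {D : Type u} (α : Ordinal.{0}) (S : RelStructure D) : Prop :=
  ∃ (A : Type) (_ : Finite A) (d : A) (L : Set (Word α A))
    (R : (i : Fin S.num) → Set (Word α (Fin (S.arity i) → A))) (h : L ≃ D),
    IsInjectivePresentation S α A L R h ∧ ∀ w ∈ L, IsFiniteWord d w

/-- The ordinal `δ` as the relational structure `(δ, <)`, the set of ordinals below `δ` with
its order. -/
def ordinalStructure (δ : Ordinal.{v}) : RelStructure (Set.Iio δ) where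
  num := 1
  arity := fun _ => 2
  rel := fun _ => {y | y 0 < y 1}

/-- The words of `L` can be represented by finite words of length `α`: there is an injective
coding of the elements of `L` by finite words over some finite alphabet with a distinguished
letter `d`, such that the set of codes is regular and the coding itself is regular, i.e. an
automaton recognizes the pairs consisting of a word of `L` and its code. -/
def IsRepresentableByFiniteWords {α : Ordinal.{0}} {A : Type} (L : Set (Word α A)) : Prop :=
  ∃ (B : Type) (_ : Finite B) (d : B) (f : Word α A → Word α B),
    Set.InjOn f L ∧ (∀ w ∈ L, IsFiniteWord d (f w)) ∧ IsRegular (f '' L) ∧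
      IsRegular ((fun w => pairWord w (f w)) '' L)

end OrdAut

/-! Fix an automaton for a countable regular language L. In an accepting run, an interval [γ, γ +
ω^(m+1)) is settled if every state met in it recurs cofinally below its end. The factor read there
depends only on the state at γ and on the set C of states cofinal at the end. Otherwise two factors
differing at some position would give two loops through the same state, both visiting exactly C, and
concatenating them in all infinite orders would put continuum many words into L
(`splice_concat_mem_language`, `eq_of_settled`). So there are finitely many settled factors.
Together with the single letters they form a finite family closed under suffixes, and every nonempty
prefix of a word of L ends with a member (`exists_factorSystem`).

A word is factorized from the right: cut at the leftmost γ from which a member reaches the end, then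
continue below γ. The cuts decrease, so they are finite in number. The code carries the name of the
member at each cut and `none` elsewhere.

For regularity, each position is labelled with the remaining suffix of its member, so finitely many
labels suffice. Suffix closure makes the leftmost choice a local condition: a member must not merge
with a remainder labelled just before its cut. Such a labelling is determined by the word and also
by the code, which makes the coding functional and injective. The checks at a limit a + ω^m depend
on m, which a finite automaton can compute (`isRegular_of_ranked`). Relations are transferred to the
codes by intersection and projection. -/

namespace OrdAut

/-! ### Ordinals as sums a + ω^m -/

section OrdinalLemmas

variable {a b i δ : Ordinal.{0}} {k m n : ℕ}

theorem omega0_pow_pos (m : ℕ) : (0 : Ordinal.{0}) < ω ^ m := by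
  rw [← opow_natCast]; exact opow_pos _ omega0_pos

theorem omega0_pow_lt_iff : (ω : Ordinal.{0}) ^ k < ω ^ m ↔ k < m := by
  rw [← opow_natCast, ← opow_natCast, opow_lt_opow_iff_right one_lt_omega0]; simp

theorem omega0_pow_le_iff : (ω : Ordinal.{0}) ^ k ≤ ω ^ m ↔ k ≤ m := by
  rw [← not_lt, omega0_pow_lt_iff, not_lt]

theorem add_omega0_pow (h : δ < ω ^ m) : δ + ω ^ m = ω ^ m := by
  rw [← opow_natCast] at *
  exact add_of_omega0_opow_le h le_rfl

theorem add_lt_omega0_pow (ha : a < ω ^ m) (hb : b < ω ^ m) : a + b < ω ^ m := by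
  rw [← opow_natCast] at *
  exact isPrincipal_add_omega0_opow _ ha hb

theorem lt_add_omega0_pow (a : Ordinal.{0}) (m : ℕ) : a < a + ω ^ m :=
  lt_add_of_pos_right a (omega0_pow_pos m)

theorem isSuccLimit_omega0_pow (h : m ≠ 0) : Order.IsSuccLimit ((ω : Ordinal.{0}) ^ m) := by
  rw [← opow_natCast]
  exact isSuccLimit_opow_left isSuccLimit_omega0 (by exact_mod_cast h)

theorem isSuccLimit_add_omega0_pow (a : Ordinal.{0}) (h : m ≠ 0) :
    Order.IsSuccLimit (a + ω ^ m) :=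
  isSuccLimit_add a (isSuccLimit_omega0_pow h)

theorem add_omega0_pow_eq_of_le_of_lt (hab : a ≤ b) (hb : b < a + ω ^ m) :
    b + ω ^ m = a + ω ^ m := by
  obtain ⟨d, rfl⟩ := exists_add_of_le hab
  rw [add_assoc, add_omega0_pow (by simpa using hb)]

theorem add_omega0_pow_inj (h : a + ω ^ k = b + ω ^ m) : k = m := by
  have key : ∀ {a b : Ordinal.{0}} {k m : ℕ}, a ≤ b → a + ω ^ k = b + ω ^ m → k = m := by
    intro a b k m hab h
    obtain ⟨d, rfl⟩ := exists_add_of_le hab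
    rw [add_assoc] at h
    have h : ω ^ k = d + ω ^ m := by simpa using h
    have hd : d < ω ^ k := h ▸ lt_add_omega0_pow d m
    have hmk : ω ^ m ≤ (ω : Ordinal.{0}) ^ k := h ▸ le_add_self
    rw [omega0_pow_le_iff] at hmk
    by_contra hne
    have := add_lt_omega0_pow hd (omega0_pow_lt_iff.2 (lt_of_le_of_ne hmk (Ne.symm hne)))
    exact absurd h.symm this.ne
  rcases le_total a b with hab | hab
  · exact key hab h
  · exact (key hab h.symm).symm

/-- The least nonzero tail of `i` is additively principal, hence a power of ω; the bound by ω^n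
makes its exponent a natural number. -/
theorem exists_eq_add_omega0_pow (hi : i ≠ 0) (hin : i ≤ ω ^ n) :
    ∃ a m, m ≤ n ∧ i = a + ω ^ m := by
  let S : Set Ordinal.{0} := {r | r ≠ 0 ∧ ∃ a, i = a + r}
  have hS : S.Nonempty := ⟨i, hi, 0, by simp⟩
  obtain ⟨hr0, a, har⟩ := csInf_mem hS
  have hp : IsPrincipal (· + ·) (sInf S) := by
    rw [isPrincipal_add_iff_add_lt_ne_self]
    intro b hb c hc hbc
    rcases eq_or_ne c 0 with rfl | hc0
    · simp only [add_zero] at hbc; exact hb.ne hbc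
    · exact notMem_of_lt_csInf' hc ⟨hc0, a + b, by rw [add_assoc, hbc]; exact har⟩
  rcases isPrincipal_add_iff_zero_or_omega0_opow.1 hp with h | ⟨e, he⟩
  · exact absurd h hr0
  have hle : (ω : Ordinal.{0}) ^ e ≤ ω ^ (n : Ordinal.{0}) := by
    rw [opow_natCast]
    exact (he.le.trans (by rw [har]; exact le_add_self)).trans hin
  rw [opow_le_opow_iff_right one_lt_omega0] at hle
  obtain ⟨m, rfl⟩ := lt_omega0.1 (hle.trans_lt (natCast_lt_omega0 n))
  refine ⟨a, m, by exact_mod_cast hle, ?_⟩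
  rw [← opow_natCast]; exact har.trans (congrArg (a + ·) he.symm)

theorem exponent_ne_zero_of_isSuccLimit (hi : Order.IsSuccLimit (a + ω ^ m)) : m ≠ 0 := by
  rintro rfl
  rw [pow_zero, ← Order.succ_eq_add_one] at hi
  exact Order.not_isSuccLimit_succ _ hi

theorem isSuccLimit_add_iff (hδ : δ ≠ 0) :
    Order.IsSuccLimit (a + δ) ↔ Order.IsSuccLimit δ := by
  refine ⟨fun h => ?_, isSuccLimit_add a⟩
  rcases zero_or_succ_or_isSuccLimit δ with h0 | ⟨d, rfl⟩ | h'
  · exact absurd h0 hδ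
  · rw [Order.succ_eq_add_one, ← add_assoc, ← Order.succ_eq_add_one] at h
    exact absurd h (Order.not_isSuccLimit_succ _)
  · exact h'

end OrdinalLemmas

/-! ### States occurring cofinally below a limit -/

section CofinalStates

variable {Q Q' : Type} {x : Ordinal.{0} → Q} {x' : Ordinal.{0} → Q} {i : Ordinal.{0}}

/-- From some point on, a sequence over a finite set only takes values it takes cofinally. -/
theorem exists_forall_mem_cofinalStates [Finite Q] (x : Ordinal.{0} → Q)
    (hi : Order.IsSuccLimit i) :
    ∃ μ < i, ∀ ν < i, μ < ν → x ν ∈ cofinalStates x i := by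
  have h : ∀ q : Q, ∃ μ < i, q ∉ cofinalStates x i → ∀ ν < i, μ < ν → x ν ≠ q := by
    intro q
    by_cases hq : q ∈ cofinalStates x i
    · exact ⟨0, by simpa using hi.bot_lt, fun h => absurd hq h⟩
    · simp only [cofinalStates, Set.mem_ofPred_eq, not_forall, not_exists, not_and] at hq
      obtain ⟨μ, hμ, h⟩ := hq
      exact ⟨μ, hμ, fun _ => h⟩
  choose μ hμ h using h
  obtain ⟨M, hM, hle⟩ : ∃ M < i, ∀ q, μ q ≤ M := by
    have := Fintype.ofFinite Q
    refine ⟨Finset.univ.sup μ, ?_, fun q => Finset.le_sup (Finset.mem_univ q)⟩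
    rw [Finset.sup_lt_iff (by simpa using hi.bot_lt)]
    exact fun q _ => hμ q
  refine ⟨M, hM, fun ν hν hMν => ?_⟩
  by_contra hq
  exact h _ hq ν hν ((hle _).trans_lt hMν) rfl

theorem exists_mem_cofinalStates [Finite Q] (x : Ordinal.{0} → Q)
    (hi : Order.IsSuccLimit i) {μ : Ordinal.{0}} (hμ : μ < i) :
    ∃ ν < i, μ < ν ∧ x ν ∈ cofinalStates x i := by
  obtain ⟨μ', hμ', h⟩ := exists_forall_mem_cofinalStates x hi
  have hm := hi.succ_lt (max_lt hμ hμ')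
  exact ⟨_, hm, (le_max_left _ _).trans_lt (Order.lt_succ _),
    h _ hm ((le_max_right _ _).trans_lt (Order.lt_succ _))⟩

/-- Finiteness of `Q` matters for ⊆: a cofinal value of the composite is attained late enough that
the underlying state is itself cofinal. -/
theorem cofinalStates_comp [Finite Q] (g : Q → Q') (x : Ordinal.{0} → Q)
    (hi : Order.IsSuccLimit i) :
    cofinalStates (fun β => g (x β)) i = g '' cofinalStates x i := by
  ext q
  constructor
  · intro hq
    obtain ⟨μ, hμ, h⟩ := exists_forall_mem_cofinalStates x hi
    obtain ⟨ν, hν, hμν, rfl⟩ := hq μ hμ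
    exact ⟨_, h ν hν hμν, rfl⟩
  · rintro ⟨q, hq, rfl⟩ μ hμ
    obtain ⟨ν, hν, hμν, rfl⟩ := hq μ hμ
    exact ⟨ν, hν, hμν, rfl⟩

/-- The set of cofinal states only depends on a final segment, up to translation. -/
theorem cofinalStates_congr {a b l : Ordinal.{0}} (hl : Order.IsSuccLimit l)
    (d : Ordinal.{0}) (hd : d < l) (h : ∀ δ, d ≤ δ → δ < l → x (a + δ) = x' (b + δ)) :
    cofinalStates x (a + l) = cofinalStates x' (b + l) := by
  have key : ∀ {a b : Ordinal.{0}} {x x' : Ordinal.{0} → Q},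
      (∀ δ, d ≤ δ → δ < l → x (a + δ) = x' (b + δ)) →
      cofinalStates x (a + l) ⊆ cofinalStates x' (b + l) := by
    intro a b x x' h q hq μ hμ
    have hm : max d (μ - b) < l := max_lt hd (sub_lt_of_lt_add hμ (by simpa using hl.bot_lt))
    obtain ⟨ν, hν, hμν, rfl⟩ := hq (a + max d (μ - b)) (by simpa using hm)
    obtain ⟨ε, rfl⟩ := exists_add_of_le (le_self_add.trans hμν.le)
    have hε : ε < l := by simpa using hν
    have hε' : max d (μ - b) < ε := by simpa using hμν
    refine ⟨b + ε, by simpa using hε, ?_, (h ε ((le_max_left _ _).trans hε'.le) hε).symm⟩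
    exact (le_add_sub μ b).trans_lt (by simpa using (le_max_right _ _).trans_lt hε')
  exact (key h).antisymm (key fun δ h1 h2 => (h δ h1 h2).symm)

theorem cofinalStates_congr' (hi : Order.IsSuccLimit i) (d : Ordinal.{0}) (hd : d < i)
    (h : ∀ δ, d ≤ δ → δ < i → x δ = x' δ) : cofinalStates x i = cofinalStates x' i := by
  simpa using cofinalStates_congr (a := 0) (b := 0) hi d hd (by simpa using h)

end CofinalStates

/-! ### Closure properties of regular languages -/

section Closure

variable {α : Ordinal.{0}} {A B : Type}

theorem IsRegular.preimage (g : A → B) {L : Set (Word α B)} (h : IsRegular L) :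
    IsRegular {w : Word α A | (fun i => g (w i)) ∈ L} := by
  obtain ⟨Q, _, M, rfl⟩ := h
  refine ⟨Q, ‹_›, ⟨M.init, {t | (t.1, g t.2.1, t.2.2) ∈ M.step}, M.limit, M.accept⟩, ?_⟩
  ext w
  exact ⟨fun ⟨x, h, hx⟩ => ⟨x, ⟨h.zero, h.succ, h.lim⟩, hx⟩,
    fun ⟨x, h, hx⟩ => ⟨x, ⟨h.zero, h.succ, h.lim⟩, hx⟩⟩

theorem IsRegular.image (g : A → B) {L : Set (Word α A)} (h : IsRegular L) :
    IsRegular ((fun (w : Word α A) i => g (w i)) '' L) := by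
  obtain ⟨Q, _, M, rfl⟩ := h
  refine ⟨Q, ‹_›, ⟨M.init, {t | ∃ a, g a = t.2.1 ∧ (t.1, a, t.2.2) ∈ M.step}, M.limit,
    M.accept⟩, ?_⟩
  ext w
  constructor
  · rintro ⟨x, h, hx⟩
    choose y hy hs using h.succ
    exact ⟨y, ⟨x, ⟨h.zero, hs, h.lim⟩, hx⟩, funext hy⟩
  · rintro ⟨y, ⟨x, h, hx⟩, rfl⟩
    exact ⟨x, ⟨h.zero, fun i => ⟨_, rfl, h.succ i⟩, h.lim⟩, hx⟩

theorem isRegular_univ : IsRegular (Set.univ : Set (Word α A)) := by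
  refine ⟨Unit, inferInstance, ⟨(), Set.univ, Set.univ, Set.univ⟩, ?_⟩
  ext w
  simpa using ⟨fun _ => (), ⟨rfl, fun _ => trivial, fun _ _ _ => trivial⟩, trivial⟩

theorem IsRegular.inter {L L' : Set (Word α A)} (h : IsRegular L) (h' : IsRegular L') :
    IsRegular (L ∩ L') := by
  obtain ⟨Q, _, M, rfl⟩ := h
  obtain ⟨Q', _, M', rfl⟩ := h'
  refine ⟨Q × Q', inferInstance, ⟨(M.init, M'.init),
    {t | (t.1.1, t.2.1, t.2.2.1) ∈ M.step ∧ (t.1.2, t.2.1, t.2.2.2) ∈ M'.step},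
    {t | (Prod.fst '' t.1, t.2.1) ∈ M.limit ∧ (Prod.snd '' t.1, t.2.2) ∈ M'.limit},
    {t | t.1 ∈ M.accept ∧ t.2 ∈ M'.accept}⟩, ?_⟩
  ext w
  constructor
  · rintro ⟨x, h, hx⟩
    refine ⟨⟨fun β => (x β).1, ⟨by simp [h.zero], fun i => (h.succ i).1, fun i hi hl => ?_⟩, hx.1⟩,
      ⟨fun β => (x β).2, ⟨by simp [h.zero], fun i => (h.succ i).2, fun i hi hl => ?_⟩, hx.2⟩⟩
    · rw [cofinalStates_comp _ _ hl]; exact (h.lim i hi hl).1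
    · rw [cofinalStates_comp _ _ hl]; exact (h.lim i hi hl).2
  · rintro ⟨⟨x, h, hx⟩, ⟨x', h', hx'⟩⟩
    refine ⟨fun β => (x β, x' β), ⟨by simp [h.zero, h'.zero], fun i => ⟨h.succ i, h'.succ i⟩,
      fun i hi hl => ⟨?_, ?_⟩⟩, hx, hx'⟩
    · rw [← cofinalStates_comp _ _ hl]; exact h.lim i hi hl
    · rw [← cofinalStates_comp _ _ hl]; exact h'.lim i hi hl

theorem IsRegular.iInter {ι : Type} [Finite ι] {L : ι → Set (Word α A)}
    (h : ∀ j, IsRegular (L j)) : IsRegular (⋂ j, L j) := by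
  classical
  have := Fintype.ofFinite ι
  have key : ∀ s : Finset ι, IsRegular (⋂ j ∈ s, L j) := by
    intro s
    induction s using Finset.induction_on with
    | empty => simpa using isRegular_univ
    | insert a s _ ih => rw [Finset.set_biInter_insert]; exact (h a).inter ih
  simpa using key Finset.univ

end Closure

/-! ### Limit transitions that depend on the exponent of the position -/

section Ranked

/-- The exponent of an ordinal: the last exponent of its Cantor normal form, capped at `n`. -/
noncomputable def exponent (n : ℕ) (β : Ordinal.{0}) : Fin (n + 1) :=
  open Classical in
  if h : ∃ m : Fin (n + 1), ∃ a, β = a + ω ^ (m : ℕ) then h.choose else 0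

theorem exponent_add_omega0_pow {n m : ℕ} (hm : m ≤ n) (a : Ordinal.{0}) :
    (exponent n (a + ω ^ m) : ℕ) = m := by
  have h : ∃ k : Fin (n + 1), ∃ b, a + ω ^ m = b + ω ^ (k : ℕ) :=
    ⟨⟨m, Nat.lt_succ_of_le hm⟩, a, rfl⟩
  rw [exponent, dif_pos h]
  obtain ⟨b, hb⟩ := h.choose_spec
  exact (add_omega0_pow_inj hb).symm

variable {A Q : Type} {n : ℕ}

theorem le_of_add_omega0_pow_le {a : Ordinal.{0}} {m : ℕ} (h : a + ω ^ m ≤ ω ^ n) : m ≤ n :=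
  omega0_pow_le_iff.1 (le_add_self.trans h)

theorem lt_of_eq_add_omega0_pow {a b ν : Ordinal.{0}} {k m : ℕ} (haν : a < ν)
    (hν : ν < a + ω ^ m) (h : ν = b + ω ^ k) : k < m := by
  obtain ⟨δ, rfl⟩ := exists_add_of_le haν.le
  have hδ : δ ≠ 0 := by rintro rfl; simp at haν
  have hδm : δ < ω ^ m := by simpa using hν
  obtain ⟨c, l, -, rfl⟩ := exists_eq_add_omega0_pow hδ hδm.le
  rw [← add_assoc] at h
  rw [← add_omega0_pow_inj h]
  exact omega0_pow_lt_iff.1 (le_add_self.trans_lt hδm)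

theorem setOf_some_mem_cofinalStates {R : Type} [Finite Q] [Finite R]
    {x : Ordinal.{0} → Option (R × Q)} {i : Ordinal.{0}} (hi : Order.IsSuccLimit i) (q₀ : Q)
    (hx : ∀ ν < i, ν ≠ 0 → x ν ≠ none) :
    {q | ∃ r, some (r, q) ∈ cofinalStates x i} =
      cofinalStates (fun β => (x β).elim q₀ Prod.snd) i := by
  rw [cofinalStates_comp (fun s : Option (R × Q) => s.elim q₀ Prod.snd) x hi]
  ext q
  constructor
  · rintro ⟨r, h⟩
    exact ⟨_, h, rfl⟩
  · rintro ⟨s, hs, rfl⟩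
    cases s with
    | none =>
      obtain ⟨ν, hν, h0, h⟩ := hs 0 (by simpa using hi.bot_lt)
      exact absurd h (hx ν hν h0.ne')
    | some p => exact ⟨p.1, hs⟩

/-- The automaton that simulates an automaton with limit transitions depending on the exponent
of the position, and with several initial states. -/
def rankedAutomaton (n : ℕ) (I : Set Q) (step : Set (Q × A × Q)) (lim : ℕ → Set Q → Q → Prop)
    (F : Set Q) : Automaton A (Option (Fin (n + 1) × Q)) where
  init := none
  step := {t | ∃ q', t.2.2 = some (0, q') ∧
    ((t.1 = none ∧ ∃ q ∈ I, (q, t.2.1, q') ∈ step) ∨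
      ∃ r q, t.1 = some (r, q) ∧ (q, t.2.1, q') ∈ step)}
  limit := {t | ∃ (r : Fin (n + 1)) (q' : Q), t.2 = some (r, q') ∧
    lim r {q | ∃ r', some (r', q) ∈ t.1} q' ∧
    (∃ (r' : Fin (n + 1)) (q : Q), some (r', q) ∈ t.1 ∧ (r : ℕ) = r' + 1) ∧
    ∀ (r' : Fin (n + 1)) (q : Q), some (r', q) ∈ t.1 → r' < r}
  accept := {s | ∃ r, ∃ q ∈ F, s = some (r, q)}

/-- In a run of `rankedAutomaton`, the first component is the exponent of the position. -/
theorem rankedAutomaton_run_eq [Finite Q] {I : Set Q} {step : Set (Q × A × Q)}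
    {lim : ℕ → Set Q → Q → Prop} {F : Set Q} {w : Word (ω ^ n) A}
    {x : Ordinal.{0} → Option (Fin (n + 1) × Q)}
    (h : (rankedAutomaton n I step lim F).IsRun w x) (β : Ordinal.{0}) :
    ∀ a m, β = a + ω ^ m → β ≤ ω ^ n → ∃ r q, x β = some (r, q) ∧ (r : ℕ) = m := by
  induction β using WellFoundedLT.induction with
  | ind β ih =>
  intro a m hβ hn
  rcases eq_or_ne m 0 with rfl | hm
  · rw [pow_zero] at hβ
    subst hβ
    obtain ⟨q', h', -⟩ := h.succ ⟨a, (lt_add_one a).trans_le hn⟩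
    exact ⟨0, q', by simpa using h', rfl⟩
  · subst hβ
    have hl := isSuccLimit_add_omega0_pow a hm
    obtain ⟨r, q', hr, -, ⟨r', q, hmem, hrr'⟩, hmax⟩ := h.lim _ hn hl
    refine ⟨r, q', hr, le_antisymm ?_ ?_⟩
    -- Upper bound: the new rank is one more than a rank that recurs, and positions strictly between
    -- a and a + ω^m have exponents below m.
    · obtain ⟨ν, hν, haν, hxν⟩ := hmem a (lt_add_omega0_pow a m)
      obtain ⟨b, k, -, hk⟩ := exists_eq_add_omega0_pow (pos_of_gt haν).ne' (hν.le.trans hn)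
      obtain ⟨r'', q'', h1, h2⟩ := ih ν hν b k hk (hν.le.trans hn)
      rw [hxν] at h1
      obtain ⟨rfl, rfl⟩ : r' = r'' ∧ q = q'' := by simpa using h1
      have := lt_of_eq_add_omega0_pow haν hν hk
      omega
    -- Lower bound: positions of exponent m - 1 occur arbitrarily late, so their rank m - 1 recurs.
    · obtain ⟨μ, hμ, hall⟩ := exists_forall_mem_cofinalStates x hl
      have hν : max a μ + ω ^ (m - 1) < a + ω ^ m := by
        rw [← add_omega0_pow_eq_of_le_of_lt (le_max_left a μ) (max_lt (lt_add_omega0_pow a m) hμ)]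
        simpa using omega0_pow_lt_iff.2 (Nat.sub_one_lt hm)
      obtain ⟨r'', q'', h1, h2⟩ := ih _ hν _ _ rfl (hν.le.trans hn)
      have hmem' := hall _ hν ((le_max_right a μ).trans_lt (lt_add_omega0_pow _ _))
      rw [h1] at hmem'
      have : (r'' : ℕ) < r := hmax _ _ hmem'
      omega

/-- The exponent can be carried in the state: it is 0 after a successor step, and at a limit it is
one more than the largest recurring exponent. Position 0 has no exponent; its state `none` also
leaves the choice in `I` to the first step. -/
theorem isRegular_of_ranked (n : ℕ) [Finite Q] (I : Set Q) (step : Set (Q × A × Q))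
    (lim : ℕ → Set Q → Q → Prop) (F : Set Q) :
    IsRegular {w : Word (ω ^ n) A | ∃ x : Ordinal.{0} → Q, x 0 ∈ I ∧
      (∀ i : Set.Iio ((ω : Ordinal.{0}) ^ n),
        (x i, w i, x (Order.succ (i : Ordinal.{0}))) ∈ step) ∧
      (∀ a m, m ≠ 0 → a + ω ^ m ≤ ω ^ n →
        lim m (cofinalStates x (a + ω ^ m)) (x (a + ω ^ m))) ∧ x (ω ^ n) ∈ F} := by
  refine ⟨_, inferInstance, rankedAutomaton n I step lim F, ?_⟩
  have hpos := omega0_pow_pos n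
  ext w
  constructor
  · rintro ⟨x, h, hx⟩
    have hrun := rankedAutomaton_run_eq h
    have h0 : x 0 = none := h.zero
    have hsome : ∀ ν ≤ ω ^ n, ν ≠ 0 → x ν ≠ none := by
      intro ν hν h0
      obtain ⟨b, k, -, hk⟩ := exists_eq_add_omega0_pow h0 hν
      obtain ⟨r, q, h1, -⟩ := hrun ν b k hk hν
      simp [h1]
    obtain ⟨q', hq', ⟨-, q₀, hq₀, hstep⟩ | ⟨r, q, h1, -⟩⟩ := h.succ ⟨0, hpos⟩
    swap
    · rw [show x _ = none from h0] at h1; cases h1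
    refine ⟨fun β => (x β).elim q₀ Prod.snd, by simpa [h0] using hq₀, fun i => ?_, ?_, ?_⟩
    · rcases eq_or_ne (i : Ordinal.{0}) 0 with hi | hi
      · obtain rfl : i = ⟨0, hpos⟩ := Subtype.ext hi
        simp only [h0]
        rw [show x (Order.succ _) = _ from hq']
        exact hstep
      · obtain ⟨q', hq', ⟨h1, -⟩ | ⟨r, q, h1, h2⟩⟩ := h.succ i
        · exact absurd h1 (hsome _ (le_of_lt i.2) hi)
        · beta_reduce
          rw [show x i = _ from h1, show x (Order.succ _) = _ from hq']
          exact h2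
    · intro a m hm han
      have hl := isSuccLimit_add_omega0_pow a hm
      rw [← setOf_some_mem_cofinalStates hl q₀ fun ν hν => hsome ν (hν.le.trans han)]
      obtain ⟨r, q', h1, h2, -⟩ := h.lim _ han hl
      obtain ⟨r', q'', h3, h4⟩ := hrun _ a m rfl han
      rw [show x _ = _ from h1] at h3
      obtain ⟨rfl, rfl⟩ : r = r' ∧ q' = q'' := by simpa using h3
      subst h4
      beta_reduce
      rw [show x _ = _ from h1]
      exact h2
    · obtain ⟨r, q, hq, h1⟩ := hx
      simpa [h1] using hq
  · rintro ⟨x, h0, hs, hlim, hF⟩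
    let x' : Ordinal.{0} → Option (Fin (n + 1) × Q) := fun β =>
      open Classical in if β = 0 then none else some (exponent n β, x β)
    have hx' : ∀ β, β ≠ 0 → x' β = some (exponent n β, x β) := fun β hβ => if_neg hβ
    have hx'0 : x' 0 = none := if_pos rfl
    have hexp : ∀ a m, a + ω ^ m ≤ ω ^ n → (exponent n (a + ω ^ m) : ℕ) = m := fun a m h =>
      exponent_add_omega0_pow (le_of_add_omega0_pow_le h) a
    refine ⟨x', ⟨hx'0, fun i => ?_, fun i hi hl => ?_⟩, exponent n (ω ^ n), x (ω ^ n), hF,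
      hx' _ hpos.ne'⟩
    · refine ⟨x (Order.succ i), ?_, ?_⟩
      · have h1 := hexp i 0 (by simpa using Order.succ_le_of_lt (Set.mem_Iio.1 i.2))
        have h2 := hx' (Order.succ i) (Order.bot_lt_succ _).ne'
        rw [show exponent n (Order.succ i) = 0 from Fin.ext (by simpa using h1)] at h2
        exact h2
      · rcases eq_or_ne (i : Ordinal.{0}) 0 with hi | hi
        · left
          refine ⟨by simpa only [hi] using hx'0, x 0, h0, ?_⟩
          have := hs i
          rw [hi] at this
          simpa only [hi] using this
        · exact Or.inr ⟨_, _, hx' _ hi, hs i⟩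
    · have hi0 : i ≠ 0 := by simpa using hl.bot_lt.ne'
      obtain ⟨a, m, -, rfl⟩ := exists_eq_add_omega0_pow hi0 hi
      have hm : m ≠ 0 := exponent_ne_zero_of_isSuccLimit hl
      have hlt : ∀ ν < a + ω ^ m, a < ν → (exponent n ν : ℕ) < m := by
        intro ν hν haν
        obtain ⟨b, k, -, rfl⟩ := exists_eq_add_omega0_pow (pos_of_gt haν).ne' (hν.le.trans hi)
        rw [hexp b k (hν.le.trans hi)]
        exact lt_of_eq_add_omega0_pow haν hν rfl
      refine ⟨_, _, hx' _ hi0, ?_, ?_, fun r' q hmem => ?_⟩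
      · rw [setOf_some_mem_cofinalStates hl (x 0) fun ν _ h => by simp [hx' ν h], hexp a m hi]
        have : (fun β => (x' β).elim (x 0) Prod.snd) = x := by
          funext β
          rcases eq_or_ne β 0 with rfl | hβ
          · simp [hx'0]
          · simp [hx' β hβ]
        rw [this]
        exact hlim a m hm hi
      · obtain ⟨μ, hμ, hall⟩ := exists_forall_mem_cofinalStates x' hl
        have hν : max a μ + ω ^ (m - 1) < a + ω ^ m := by
          rw [← add_omega0_pow_eq_of_le_of_lt (le_max_left a μ)
            (max_lt (lt_add_omega0_pow a m) hμ)]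
          simpa using omega0_pow_lt_iff.2 (Nat.sub_one_lt hm)
        have hmem := hall _ hν ((le_max_right a μ).trans_lt (lt_add_omega0_pow _ _))
        rw [hx' _ (pos_of_gt (lt_add_omega0_pow (max a μ) (m - 1))).ne'] at hmem
        refine ⟨_, _, hmem, ?_⟩
        rw [hexp a m hi, hexp _ _ (hν.le.trans hi)]
        omega
      · obtain ⟨ν, hν, haν, h⟩ := hmem a (lt_add_omega0_pow a m)
        rw [hx' _ (pos_of_gt haν).ne'] at h
        obtain ⟨rfl, rfl⟩ : exponent n ν = r' ∧ x ν = q := by simpa using h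
        rw [Fin.lt_def, hexp a m hi]
        exact hlt ν hν haν

end Ranked

/-! ### Pumping: rearranging loops inside an accepting run -/

section Splice

variable {A Q : Type} {M : Automaton A Q} {m : ℕ}

/-- The limit condition of a run at the single position `i`. -/
def Automaton.LimAt (M : Automaton A Q) (x : Ordinal.{0} → Q) (i : Ordinal.{0}) : Prop :=
  Order.IsSuccLimit i → (cofinalStates x i, x i) ∈ M.limit

theorem Automaton.LimAt.congr {x x' : Ordinal.{0} → Q} {a b l : Ordinal.{0}} (hl : l ≠ 0)
    (h : ∀ δ ≤ l, x (a + δ) = x' (b + δ)) (hx' : M.LimAt x' (b + l)) : M.LimAt x (a + l) := by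
  intro hlim
  have hl' := (isSuccLimit_add_iff hl).1 hlim
  rw [cofinalStates_congr hl' 0 (by simpa using hl'.bot_lt) fun δ _ hδ => h δ hδ.le, h l le_rfl]
  exact hx' (isSuccLimit_add b hl')

theorem Automaton.isRun_iff {α : Ordinal.{0}} {y : Ordinal.{0} → A} {x : Ordinal.{0} → Q} :
    M.IsRun (fun i : Set.Iio α => y i) x ↔ x 0 = M.init ∧
      (∀ i < α, (x i, y i, x (i + 1)) ∈ M.step) ∧ ∀ i ≤ α, M.LimAt x i :=
  ⟨fun h => ⟨h.zero, fun i hi => h.succ ⟨i, hi⟩, h.lim⟩,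
    fun h => ⟨h.1, fun i => h.2.1 i i.2, h.2.2⟩⟩

/-- The starting positions of the blocks in the infinite concatenation of blocks of lengths
`ℓ (s 0)`, `ℓ (s 1)`, … -/
def offset (ℓ : Bool → Ordinal.{0}) (s : ℕ → Bool) : ℕ → Ordinal.{0}
  | 0 => 0
  | i + 1 => offset ℓ s i + ℓ (s i)

/-- The infinite concatenation of the blocks `Y (s 0)`, `Y (s 1)`, … of lengths `ℓ (s 0)`,
`ℓ (s 1)`, … -/
noncomputable def concat {E : Type} (ℓ : Bool → Ordinal.{0}) (Y : Bool → Ordinal.{0} → E)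
    (s : ℕ → Bool) (δ : Ordinal.{0}) : E :=
  Y (s (sInf {i | δ < offset ℓ s (i + 1)})) (δ - offset ℓ s (sInf {i | δ < offset ℓ s (i + 1)}))

section Offset

variable {ℓ : Bool → Ordinal.{0}} {s s' : ℕ → Bool}

theorem offset_monotone : Monotone (offset ℓ s) :=
  monotone_nat_of_le_succ fun _ => le_self_add

theorem offset_congr {i : ℕ} (h : ∀ j < i, s j = s' j) : offset ℓ s i = offset ℓ s' i := by
  induction i with
  | zero => rfl
  | succ i ih =>
    rw [offset, offset, ih fun j hj => h j (hj.trans i.lt_succ_self), h i i.lt_succ_self]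

theorem offset_lt (hℓ : ∀ b, ℓ b < ω ^ m) (i : ℕ) : offset ℓ s i < ω ^ m := by
  induction i with
  | zero => exact omega0_pow_pos m
  | succ i ih => exact add_lt_omega0_pow ih (hℓ _)

theorem mul_le_offset (hℓ : ∀ b, ω ^ m ≤ ℓ b) (i : ℕ) : ω ^ m * (i : Ordinal.{0}) ≤ offset ℓ s i := by
  induction i with
  | zero => simp
  | succ i ih =>
    rw [Nat.cast_succ, mul_add_one, offset]
    exact add_le_add ih (hℓ _)

/-- Blocks of length at least ω^m, concatenated ω times, exhaust ω^m * ω. -/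
theorem exists_lt_offset (hℓ : ∀ b, ω ^ m ≤ ℓ b) {δ : Ordinal.{0}} (hδ : δ < ω ^ (m + 1)) :
    ∃ i, δ < offset ℓ s i := by
  rw [pow_succ, lt_mul_iff_of_isSuccLimit isSuccLimit_omega0] at hδ
  obtain ⟨c, hc, h⟩ := hδ
  obtain ⟨i, rfl⟩ := lt_omega0.1 hc
  exact ⟨i, h.trans_le (mul_le_offset hℓ i)⟩

theorem exists_eq_offset_add (hℓ : ∀ b, ω ^ m ≤ ℓ b) {δ : Ordinal.{0}} (hδ : δ < ω ^ (m + 1)) :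
    ∃ i, ∃ ε < ℓ (s i), δ = offset ℓ s i + ε := by
  classical
  have h := exists_lt_offset (s := s) hℓ hδ
  have h0 : Nat.find h ≠ 0 := by
    intro h0
    have := Nat.find_spec h
    rw [h0] at this
    exact absurd this (not_lt.2 zero_le)
  obtain ⟨i, hi⟩ := Nat.exists_eq_succ_of_ne_zero h0
  have hle : offset ℓ s i ≤ δ := not_lt.1 (Nat.find_min h (by omega))
  have hlt : δ < offset ℓ s (i + 1) := by simpa [hi] using Nat.find_spec h
  obtain ⟨ε, rfl⟩ := exists_add_of_le hle
  exact ⟨i, ε, by simpa [offset] using hlt, rfl⟩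

/-- Limit conditions look to the left, so a block boundary is counted here as the end of the
preceding block. -/
theorem exists_eq_offset_add_of_ne_zero (hℓ : ∀ b, ω ^ m ≤ ℓ b) {δ : Ordinal.{0}} (h0 : δ ≠ 0)
    (hδ : δ < ω ^ (m + 1)) : ∃ i, ∃ ε ≤ ℓ (s i), ε ≠ 0 ∧ δ = offset ℓ s i + ε := by
  obtain ⟨i, ε, hε, rfl⟩ := exists_eq_offset_add (s := s) hℓ hδ
  rcases eq_or_ne ε 0 with rfl | hε0
  · cases i with
    | zero => simp [offset] at h0
    | succ i =>
      exact ⟨i, _, le_rfl, ((omega0_pow_pos m).trans_le (hℓ _)).ne', by simp [offset]⟩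
  · exact ⟨i, ε, hε.le, hε0, rfl⟩

theorem concat_offset_add {E : Type} {Y : Bool → Ordinal.{0} → E} (i : ℕ) {ε : Ordinal.{0}}
    (hε : ε < ℓ (s i)) : concat ℓ Y s (offset ℓ s i + ε) = Y (s i) ε := by
  have h : sInf {j | offset ℓ s i + ε < offset ℓ s (j + 1)} = i := by
    have hi : offset ℓ s i + ε < offset ℓ s (i + 1) := by simpa [offset] using hε
    refine le_antisymm (Nat.sInf_le hi) (le_csInf ⟨i, hi⟩ fun j hj => ?_)
    by_contra hji
    exact absurd (hj.trans_le (offset_monotone (by omega : j + 1 ≤ i))) (not_lt.2 le_self_add)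
  rw [concat, h, add_sub_cancel]

theorem concat_offset_add_of_le {E : Type} {Y : Bool → Ordinal.{0} → E} {q : E}
    (hpos : ∀ b, 0 < ℓ b) (h0 : ∀ b, Y b 0 = q) (hℓ : ∀ b, Y b (ℓ b) = q) (i : ℕ)
    {ε : Ordinal.{0}} (hε : ε ≤ ℓ (s i)) : concat ℓ Y s (offset ℓ s i + ε) = Y (s i) ε := by
  rcases hε.lt_or_eq with h | rfl
  · exact concat_offset_add i h
  · have := concat_offset_add (ℓ := ℓ) (Y := Y) (i + 1) (hpos (s (i + 1)))
    rw [add_zero, offset, h0] at this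
    rw [this, hℓ]

end Offset

/-- Replacement of the factor on `[γ, γ + l)` by `z`. -/
noncomputable def splice {E : Type} (y z : Ordinal.{0} → E) (γ l β : Ordinal.{0}) : E :=
  open Classical in if γ ≤ β ∧ β < γ + l then z (β - γ) else y β

section SpliceLemmas

variable {E : Type} {y z : Ordinal.{0} → E} {γ l β δ : Ordinal.{0}}

theorem splice_of_lt (h : β < γ) : splice y z γ l β = y β :=
  if_neg fun h' => absurd h (not_lt.2 h'.1)

theorem splice_of_ge (h : γ + l ≤ β) : splice y z γ l β = y β :=
  if_neg fun h' => absurd h'.2 (not_lt.2 h)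

theorem splice_add (h : δ < l) : splice y z γ l (γ + δ) = z δ := by
  rw [splice, if_pos ⟨le_self_add, by simpa using h⟩, add_sub_cancel]

theorem splice_of_le (hl : 0 < l) (hγ : z 0 = y γ) (h : β ≤ γ) : splice y z γ l β = y β := by
  rcases h.lt_or_eq with h | rfl
  · exact splice_of_lt h
  · have := splice_add (y := y) (z := z) (γ := β) hl
    rw [add_zero] at this
    rw [this, hγ]

end SpliceLemmas

/-- Two loops through the same state that visit exactly the states of `C` can be arranged in any
infinite order inside an accepting run. -/
theorem splice_concat_mem_language {α γ : Ordinal.{0}} {y : Ordinal.{0} → A}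
    {x : Ordinal.{0} → Q} (hrun : M.IsRun (fun i : Set.Iio α => y i) x) (hacc : x α ∈ M.accept)
    (hγ : γ + ω ^ (m + 1) ≤ α) {ℓ : Bool → Ordinal.{0}} {Y : Bool → Ordinal.{0} → A}
    {X : Bool → Ordinal.{0} → Q} (hℓ : ∀ b, ω ^ m ≤ ℓ b) (hℓ' : ∀ b, ℓ b < ω ^ (m + 1))
    (hX0 : ∀ b, X b 0 = x γ) (hXℓ : ∀ b, X b (ℓ b) = x γ)
    (hstep : ∀ b, ∀ δ < ℓ b, (X b δ, Y b δ, X b (δ + 1)) ∈ M.step)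
    (hlim : ∀ b, ∀ δ ≤ ℓ b, M.LimAt (X b) δ)
    (hsub : ∀ b, ∀ δ ≤ ℓ b, X b δ ∈ cofinalStates x (γ + ω ^ (m + 1)))
    (hsup : ∀ b, ∀ c ∈ cofinalStates x (γ + ω ^ (m + 1)), ∃ δ ≤ ℓ b, X b δ = c)
    (s : ℕ → Bool) :
    (fun i : Set.Iio α => splice y (concat ℓ Y s) γ (ω ^ (m + 1)) i) ∈ M.language α := by
  have hpos : ∀ b, 0 < ℓ b := fun b => (omega0_pow_pos m).trans_le (hℓ b)
  have hX : ∀ i, ∀ ε ≤ ℓ (s i), concat ℓ X s (offset ℓ s i + ε) = X (s i) ε := fun i ε hε =>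
    concat_offset_add_of_le hpos hX0 hXℓ i hε
  set R := splice x (concat ℓ X s) γ (ω ^ (m + 1)) with hR
  have hle : ∀ β ≤ γ, R β = x β := fun β hβ => splice_of_le (omega0_pow_pos _)
    (by simpa [hX0, offset] using hX 0 0 zero_le) hβ
  have hge : ∀ β, γ + ω ^ (m + 1) ≤ β → R β = x β := fun β hβ => splice_of_ge hβ
  have hmid : ∀ i, ∀ ε ≤ ℓ (s i), R (γ + offset ℓ s i + ε) = X (s i) ε := fun i ε hε => by
    rw [add_assoc, hR, splice_add (add_lt_omega0_pow (offset_lt hℓ' i) (hε.trans_lt (hℓ' _))),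
      hX i ε hε]
  rw [Automaton.isRun_iff] at hrun
  obtain ⟨h0, hs, hl⟩ := hrun
  refine ⟨R, Automaton.isRun_iff.2 ⟨?_, fun i hi => ?_, fun i hi => ?_⟩, ?_⟩
  · rw [hle 0 zero_le, h0]
  · rcases lt_or_ge i γ with h1 | h1
    · rw [hle i h1.le, hle (i + 1) (Order.add_one_le_of_lt h1), splice_of_lt h1]
      exact hs i hi
    rcases lt_or_ge i (γ + ω ^ (m + 1)) with h2 | h2
    · obtain ⟨δ, rfl⟩ := exists_add_of_le h1
      have hδ : δ < ω ^ (m + 1) := by simpa using h2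
      rw [splice_add hδ]
      obtain ⟨j, ε, hε, rfl⟩ := exists_eq_offset_add (s := s) hℓ hδ
      have h3 := hmid j (ε + 1) (Order.add_one_le_of_lt hε)
      rw [concat_offset_add j hε, ← add_assoc γ, hmid j ε hε.le, add_assoc _ ε, h3]
      exact hstep _ _ hε
    · rw [hge i h2, hge (i + 1) (h2.trans le_self_add), splice_of_ge h2]
      exact hs i hi
  · rcases le_or_gt i γ with h1 | h1
    · rcases eq_or_ne i 0 with rfl | hi0
      · exact fun h => absurd h not_isSuccLimit_zero
      · have := Automaton.LimAt.congr (M := M) (x := R) (x' := x) (a := 0) (b := 0) hi0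
          (fun δ hδ => by simpa using hle δ (hδ.trans h1)) (by simpa using hl i hi)
        simpa using this
    rcases lt_trichotomy i (γ + ω ^ (m + 1)) with h2 | rfl | h2
    · obtain ⟨δ, rfl⟩ := exists_add_of_le h1.le
      have hδ : δ < ω ^ (m + 1) := by simpa using h2
      have hδ0 : δ ≠ 0 := by rintro rfl; simp at h1
      obtain ⟨j, ε, hε, hε0, rfl⟩ := exists_eq_offset_add_of_ne_zero (s := s) hℓ hδ0 hδ
      rw [← add_assoc]
      exact Automaton.LimAt.congr (x' := X (s j)) (b := 0) hε0
        (fun δ hδ => by simpa using hmid j δ (hδ.trans hε)) (by simpa using hlim _ _ hε)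
    · intro hlimit
      -- Each block visits all states of the cofinal set and no others, so the limit transition of
      -- the original run still applies.
      have : cofinalStates R (γ + ω ^ (m + 1)) = cofinalStates x (γ + ω ^ (m + 1)) := by
        ext c
        constructor
        · intro hc
          obtain ⟨ν, hν, hγν, rfl⟩ := hc γ h1
          obtain ⟨δ, rfl⟩ := exists_add_of_le hγν.le
          obtain ⟨j, ε, hε, rfl⟩ := exists_eq_offset_add (s := s) hℓ (by simpa using hν)
          rw [← add_assoc, hmid j ε hε.le]
          exact hsub _ _ hε.le
        · intro hc μ hμ
          obtain ⟨j, hj⟩ := exists_lt_offset (s := s) hℓ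
            (sub_lt_of_lt_add hμ (omega0_pow_pos (m + 1)))
          obtain ⟨ε, hε, rfl⟩ := hsup (s j) c hc
          refine ⟨γ + offset ℓ s j + ε, ?_, ?_, hmid j ε hε⟩
          · rw [add_assoc]
            simpa using add_lt_omega0_pow (offset_lt hℓ' j) (hε.trans_lt (hℓ' _))
          · exact ((le_add_sub μ γ).trans_lt (by simpa using hj)).trans_le le_self_add
      rw [this, hge _ le_rfl]
      exact hl _ hi hlimit
    · obtain ⟨ε, rfl⟩ := exists_add_of_le h2.le
      have hε0 : ε ≠ 0 := by rintro rfl; simp at h2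
      exact Automaton.LimAt.congr hε0 (fun δ _ => hge _ le_self_add) (hl _ hi)
  · rw [hge α hγ]
    exact hacc

/-- A run is settled on `[γ, γ + l)` if all states visited there are visited cofinally below
`γ + l`. -/
def Settled (x : Ordinal.{0} → Q) (γ l : Ordinal.{0}) : Prop :=
  ∀ δ < l, x (γ + δ) ∈ cofinalStates x (γ + l)

/-- Settledness makes `x γ` itself recur. It suffices to take a return to it beyond β, beyond ω^m,
and beyond one visit to each of the finitely many cofinal states. -/
theorem Settled.exists_loop [Finite Q] {x : Ordinal.{0} → Q} {γ : Ordinal.{0}}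
    (h : Settled x γ (ω ^ (m + 1))) {β : Ordinal.{0}} (hβ : β < ω ^ (m + 1)) :
    ∃ l, β < l ∧ ω ^ m ≤ l ∧ l < ω ^ (m + 1) ∧ x (γ + l) = x γ ∧
      ∀ c ∈ cofinalStates x (γ + ω ^ (m + 1)), ∃ δ ≤ l, x (γ + δ) = c := by
  have hvis : ∀ c ∈ cofinalStates x (γ + ω ^ (m + 1)), ∀ β < ω ^ (m + 1), ∃ δ < ω ^ (m + 1),
      β < δ ∧ x (γ + δ) = c := by
    intro c hc β hβ
    obtain ⟨ν, hν, hβν, rfl⟩ := hc (γ + β) (by simpa using hβ)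
    obtain ⟨δ, rfl⟩ := exists_add_of_le (le_self_add.trans hβν.le)
    exact ⟨δ, by simpa using hν, by simpa using hβν, rfl⟩
  have h1 : ∀ c : Q, ∃ δ < ω ^ (m + 1), c ∈ cofinalStates x (γ + ω ^ (m + 1)) →
      x (γ + δ) = c := by
    intro c
    by_cases hc : c ∈ cofinalStates x (γ + ω ^ (m + 1))
    · obtain ⟨δ, hδ, -, h⟩ := hvis c hc 0 (omega0_pow_pos _)
      exact ⟨δ, hδ, fun _ => h⟩
    · exact ⟨0, omega0_pow_pos _, fun h => absurd h hc⟩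
  choose D hD hxD using h1
  have := Fintype.ofFinite Q
  have hsup : Finset.univ.sup D < ω ^ (m + 1) := by
    rw [Finset.sup_lt_iff (by simp)]
    exact fun q _ => hD q
  have h0 : x γ ∈ cofinalStates x (γ + ω ^ (m + 1)) := by simpa using h 0 (omega0_pow_pos _)
  obtain ⟨l, hl, hml, hxl⟩ := hvis _ h0 (max β (max (ω ^ m) (Finset.univ.sup D)))
    (max_lt hβ (max_lt (omega0_pow_lt_iff.2 m.lt_succ_self) hsup))
  simp only [max_lt_iff] at hml
  exact ⟨l, hml.1, hml.2.1.le, hl, hxl, fun c hc =>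
    ⟨D c, (Finset.le_sup (Finset.mem_univ c)).trans hml.2.2.le, hxD c hc⟩⟩

/-- In a countable regular language, a factor read by an accepting run on a settled interval is
determined by the state at the beginning and the cofinal states at the end. -/
theorem eq_of_settled [Finite Q] {α γ γ' : Ordinal.{0}} {y y' : Ordinal.{0} → A}
    {x x' : Ordinal.{0} → Q} (hL : (M.language α).Countable)
    (hrun : M.IsRun (fun i : Set.Iio α => y i) x) (hacc : x α ∈ M.accept)
    (hrun' : M.IsRun (fun i : Set.Iio α => y' i) x')
    (hγ : γ + ω ^ (m + 1) ≤ α) (hγ' : γ' + ω ^ (m + 1) ≤ α)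
    (hs : Settled x γ (ω ^ (m + 1))) (hs' : Settled x' γ' (ω ^ (m + 1))) (hx : x γ = x' γ')
    (hC : cofinalStates x (γ + ω ^ (m + 1)) = cofinalStates x' (γ' + ω ^ (m + 1)))
    {β : Ordinal.{0}} (hβ : β < ω ^ (m + 1)) : y (γ + β) = y' (γ' + β) := by
  by_contra hne
  obtain ⟨l, hβl, hml, hlm, hxl, hvis⟩ := hs.exists_loop hβ
  obtain ⟨l', hβl', hml', hlm', hxl', hvis'⟩ := hs'.exists_loop hβ
  have key : ∀ {γ l : Ordinal.{0}} {y : Ordinal.{0} → A} {x : Ordinal.{0} → Q},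
      M.IsRun (fun i : Set.Iio α => y i) x → γ + ω ^ (m + 1) ≤ α → l < ω ^ (m + 1) →
      (∀ δ < l, (x (γ + δ), y (γ + δ), x (γ + (δ + 1))) ∈ M.step) ∧
      ∀ δ ≤ l, M.LimAt (fun δ => x (γ + δ)) δ := by
    intro γ l y x h hγ hl
    rw [Automaton.isRun_iff] at h
    have hlt : ∀ δ ≤ l, γ + δ < α := fun δ hδ =>
      lt_of_lt_of_le (by simpa using hδ.trans_lt hl) hγ
    refine ⟨fun δ hδ => ?_, fun δ hδ => ?_⟩
    · rw [← add_assoc]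
      exact h.2.1 _ (hlt δ hδ.le)
    · rcases eq_or_ne δ 0 with rfl | hδ0
      · exact fun h => absurd h not_isSuccLimit_zero
      · have := Automaton.LimAt.congr (M := M) (x := fun δ => x (γ + δ)) (x' := x) (a := 0)
          (b := γ) hδ0 (fun ε _ => by simp) (h.2.2 _ (hlt δ hδ).le)
        simpa using this
  obtain ⟨hst, hli⟩ := key hrun hγ hlm
  obtain ⟨hst', hli'⟩ := key hrun' hγ' hlm'
  let ℓ : Bool → Ordinal.{0} := fun b => if b then l else l'
  let Y : Bool → Ordinal.{0} → A := fun b δ => if b then y (γ + δ) else y' (γ' + δ)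
  let X : Bool → Ordinal.{0} → Q := fun b δ => if b then x (γ + δ) else x' (γ' + δ)
  have hmem := splice_concat_mem_language hrun hacc hγ (ℓ := ℓ) (Y := Y) (X := X)
    (by simp [ℓ, hml, hml']) (by simp [ℓ, hlm, hlm']) (by simp [X, hx]) (by simp [X, ℓ, hx, hxl, hxl'])
    (by simpa [X, Y, ℓ] using ⟨hst', hst⟩) (by simpa [X, ℓ] using ⟨hli', hli⟩)
    (by
      simp only [Bool.forall_bool, X, ℓ]
      exact ⟨fun δ hδ => by rw [hC]; exact hs' δ (lt_of_le_of_lt hδ hlm'),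
        fun δ hδ => hs δ (lt_of_le_of_lt hδ hlm)⟩)
    (by
      simp only [Bool.forall_bool, X, ℓ]
      exact ⟨fun c hc => hvis' c (hC ▸ hc), hvis⟩)
  -- Both loops run past β, so either one displays its letter at β, where the two factors differ.
  have hβℓ : ∀ b, β < ℓ b := by simp [ℓ, hβl, hβl']
  have hinj : Function.Injective fun s : ℕ → Bool =>
      (⟨_, hmem s⟩ : M.language α) := by
    intro s s' hss
    by_contra hne'
    classical
    have hex : ∃ i, s i ≠ s' i := by
      by_contra h
      push Not at h
      exact hne' (funext h)
    set i := Nat.find hex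
    have hi : s i ≠ s' i := Nat.find_spec hex
    -- Up to the first difference of `s` and `s'` the blocks agree, so the differing blocks start at
    -- the same offset and their letters at β can be compared.
    have ho : offset ℓ s i = offset ℓ s' i := offset_congr fun j hj => by
      simpa using Nat.find_min hex hj
    have hlt : offset ℓ s i + β < ω ^ (m + 1) :=
      add_lt_omega0_pow (offset_lt (by simp [ℓ, hlm, hlm']) i) hβ
    have h1 := congrFun (congrArg Subtype.val hss)
      ⟨γ + (offset ℓ s i + β), lt_of_lt_of_le (by simpa using hlt) hγ⟩
    simp only [splice_add hlt] at h1
    rw [concat_offset_add i (hβℓ _), ho, concat_offset_add i (hβℓ _)] at h1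
    cases hb : s i <;> cases hb' : s' i <;> simp_all [Y]
  have : Countable (M.language α) := hL
  have : Countable (ℕ → Bool) := hinj.countable
  -- Cantor's diagonal argument.
  obtain ⟨f, hf⟩ := exists_surjective_nat (ℕ → Bool)
  obtain ⟨k, hk⟩ := hf fun i => !f i i
  simpa using congrFun hk k

end Splice

/-! ### Finite systems of factors -/

section Factors

variable {A Q : Type}

/-- The extension of a word by `none` to all ordinals. -/
noncomputable def Word.ext {α : Ordinal.{0}} (w : Word α A) (β : Ordinal.{0}) : Option A :=
  open Classical in if h : β < α then some (w ⟨β, h⟩) else none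

/-- The factor of length `ω ^ m` of `u` at position `γ`, extended by `none`. -/
noncomputable def seg (u : Ordinal.{0} → Option A) (γ : Ordinal.{0}) (m : ℕ)
    (δ : Ordinal.{0}) : Option A :=
  open Classical in if δ < ω ^ m then u (γ + δ) else none

theorem Word.ext_of_lt {α β : Ordinal.{0}} (w : Word α A) (h : β < α) :
    w.ext β = some (w ⟨β, h⟩) := dif_pos h

variable {u : Ordinal.{0} → Option A} {γ δ : Ordinal.{0}} {k m : ℕ}

theorem seg_of_lt (h : δ < ω ^ m) : seg u γ m δ = u (γ + δ) := if_pos h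

theorem seg_of_ge (h : ω ^ m ≤ δ) : seg u γ m δ = none := if_neg (not_lt.2 h)

theorem seg_seg (h : δ + ω ^ k ≤ ω ^ m) : seg (seg u γ m) δ k = seg u (γ + δ) k := by
  funext ε
  rcases lt_or_ge ε (ω ^ k) with hε | hε
  · rw [seg_of_lt hε, seg_of_lt hε, seg_of_lt (lt_of_lt_of_le (by simpa using hε) h), add_assoc]
  · rw [seg_of_ge hε, seg_of_ge hε]

theorem Word.seg_ext_ne_none_iff {α : Ordinal.{0}} (w : Word α A) (h : γ + ω ^ m ≤ α) :
    seg w.ext γ m δ ≠ none ↔ δ < ω ^ m := by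
  rcases lt_or_ge δ (ω ^ m) with hδ | hδ
  · rw [seg_of_lt hδ, w.ext_of_lt (lt_of_lt_of_le (by simpa using hδ) h)]
    simpa using hδ
  · simpa [seg_of_ge hδ] using hδ

/-- A finite set of words whose lengths are powers of `ω`, closed under nonempty suffixes. -/
structure FactorSystem (A : Type) where
  /-- names of the words -/
  K : Type
  finite : Finite K
  /-- the exponent of the length -/
  len : K → ℕ
  /-- the words, extended by `none` -/
  word : K → Ordinal.{0} → Option A
  injective : Function.Injective word
  ne_none_iff : ∀ t δ, word t δ ≠ none ↔ δ < ω ^ len t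
  exists_tail : ∀ t, ∀ δ < ω ^ len t, ∃ t', word t' = seg (word t) δ (len t)

/-- Every nonempty prefix of `u` of length at most `l` ends with a word of the system. -/
def FactorSystem.Covers (S : FactorSystem A) (u : Ordinal.{0} → Option A) (l : Ordinal.{0}) :
    Prop :=
  ∀ i ≤ l, i ≠ 0 → ∃ γ t, γ + ω ^ S.len t = i ∧ S.word t = seg u γ (S.len t)

/-- The factors read by accepting runs of `M` on settled intervals, and the letters read by
accepting runs of `M`. -/
def settledFactors (M : Automaton A Q) (α : Ordinal.{0}) (m : ℕ) :
    Set (Ordinal.{0} → Option A) :=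
  {f | ∃ (w : Word α A) (x : Ordinal.{0} → Q) (γ : Ordinal.{0}), M.IsRun w x ∧
    x α ∈ M.accept ∧ γ + ω ^ m ≤ α ∧ (m ≠ 0 → Settled x γ (ω ^ m)) ∧ f = seg w.ext γ m}

theorem Word.exists_total {α : Ordinal.{0}} (w : Word α A) (hα : 0 < α) :
    ∃ y : Ordinal.{0} → A, w = (fun i : Set.Iio α => y i) ∧ ∀ β < α, w.ext β = some (y β) := by
  refine ⟨fun β => (w.ext β).getD (w ⟨0, hα⟩), ?_, fun β hβ => ?_⟩
  · funext i
    simp [w.ext_of_lt i.2]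
  · simp [w.ext_of_lt hβ]

/-- Factors of length 1 are letters. For longer ones, `eq_of_settled` makes the pair of starting
state and cofinal set an injective invariant with values in a finite type. -/
theorem finite_settledFactors [Finite A] [Finite Q] {M : Automaton A Q} {α : Ordinal.{0}}
    (hL : (M.language α).Countable) (m : ℕ) : (settledFactors M α m).Finite := by
  cases m with
  | zero =>
    refine (Set.finite_range fun (a : Option A) δ => seg (fun _ => a) 0 0 δ).subset ?_
    rintro f ⟨w, x, γ, -, -, hγ, -, rfl⟩
    refine ⟨w.ext γ, funext fun δ => ?_⟩
    rcases lt_or_ge δ (ω ^ 0) with hδ | hδ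
    · obtain rfl : δ = 0 := by simpa using hδ
      simp [seg]
    · simp only [seg_of_ge hδ]
  | succ m =>
    have key : ∀ f : settledFactors M α (m + 1), ∃ p : Q × Set Q,
        ∃ (w : Word α A) (x : Ordinal.{0} → Q) (γ : Ordinal.{0}), M.IsRun w x ∧
          x α ∈ M.accept ∧ γ + ω ^ (m + 1) ≤ α ∧ Settled x γ (ω ^ (m + 1)) ∧
          f.1 = seg w.ext γ (m + 1) ∧ p = (x γ, cofinalStates x (γ + ω ^ (m + 1))) := by
      rintro ⟨f, w, x, γ, h1, h2, h3, h4, h5⟩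
      exact ⟨_, w, x, γ, h1, h2, h3, h4 m.succ_ne_zero, h5, rfl⟩
    choose p hp using key
    refine Set.finite_coe_iff.1 (Finite.of_injective p ?_)
    intro f f' hff
    obtain ⟨w, x, γ, hrun, hacc, hγ, hs, hf, hpf⟩ := hp f
    obtain ⟨w', x', γ', hrun', -, hγ', hs', hf', hpf'⟩ := hp f'
    rw [hpf, hpf'] at hff
    obtain ⟨hx, hC⟩ := Prod.mk.inj hff
    have hα : 0 < α := (omega0_pow_pos _).trans_le (le_add_self.trans hγ)
    obtain ⟨y, rfl, hy⟩ := w.exists_total hα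
    obtain ⟨y', rfl, hy'⟩ := w'.exists_total hα
    refine Subtype.ext ?_
    rw [hf, hf']
    funext δ
    rcases lt_or_ge δ (ω ^ (m + 1)) with hδ | hδ
    · rw [seg_of_lt hδ, seg_of_lt hδ, hy _ (lt_of_lt_of_le (by simpa using hδ) hγ),
        hy' _ (lt_of_lt_of_le (by simpa using hδ) hγ'),
        eq_of_settled hL hrun hacc hrun' hγ hγ' hs hs' hx hC hδ]
    · rw [seg_of_ge hδ, seg_of_ge hδ]

/-- Move the start past the point after which only recurring states occur; ω^m absorbs the shift, so
the end does not move. -/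
theorem exists_settled [Finite Q] (x : Ordinal.{0} → Q) (a : Ordinal.{0}) (hm : m ≠ 0) :
    ∃ γ, γ + ω ^ m = a + ω ^ m ∧ Settled x γ (ω ^ m) := by
  have hl := isSuccLimit_add_omega0_pow a hm
  obtain ⟨μ, hμ, h⟩ := exists_forall_mem_cofinalStates x hl
  have hγ := add_omega0_pow_eq_of_le_of_lt (le_max_left a (Order.succ μ))
    (max_lt (lt_add_omega0_pow a m) (hl.succ_lt hμ))
  refine ⟨_, hγ, fun δ hδ => ?_⟩
  rw [hγ]
  refine h _ ?_ ?_
  · rw [← hγ]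
    simpa using hδ
  · exact (Order.lt_succ μ).trans_le ((le_max_right _ _).trans le_self_add)

/-- The words of a countable regular language are covered by a finite system of factors. -/
theorem exists_factorSystem [Finite A] [Finite Q] {n : ℕ} {M : Automaton A Q}
    (hL : (M.language (ω ^ n)).Countable) :
    ∃ S : FactorSystem A, ∀ w ∈ M.language (ω ^ n), S.Covers (Word.ext w) (ω ^ n) := by
  let T : Set (Ordinal.{0} → Option A) := ⋃ m ∈ Set.Iic n, settledFactors M (ω ^ n) m
  have hT : T.Finite := (Set.finite_Iic n).biUnion fun m _ => finite_settledFactors hL m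
  have hmem : ∀ f, f ∈ T ↔ ∃ m, f ∈ settledFactors M (ω ^ n) m := by
    intro f
    simp only [T, Set.mem_iUnion, exists_prop, Set.mem_Iic]
    refine ⟨fun ⟨m, _, h⟩ => ⟨m, h⟩, fun ⟨m, h⟩ => ⟨m, ?_, h⟩⟩
    obtain ⟨w, x, γ, -, -, hγ, -⟩ := h
    exact le_of_add_omega0_pow_le hγ
  have := hT.to_subtype
  -- The factors live in `Type 1`, whereas the names must form a `Type` to serve as letters and
  -- states; hence the passage to `Fin k`.
  obtain ⟨k, ⟨e⟩⟩ := Finite.exists_equiv_fin T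
  choose len hlen using fun t : T => (hmem t).1 t.2
  have hne : ∀ t : T, ∀ m, t.1 ∈ settledFactors M (ω ^ n) m → ∀ δ, t.1 δ ≠ none ↔ δ < ω ^ m := by
    rintro t m ⟨w, x, γ, -, -, hγ, -, h⟩ δ
    rw [h]
    exact w.seg_ext_ne_none_iff hγ
  have hlen_eq : ∀ t : T, ∀ m, t.1 ∈ settledFactors M (ω ^ n) m → len t = m := by
    intro t m hm
    have h : ∀ δ, δ < ω ^ len t ↔ δ < ω ^ m := fun δ => by
      rw [← hne t _ (hlen t), ← hne t _ hm]
    refine le_antisymm (omega0_pow_le_iff.1 ?_) (omega0_pow_le_iff.1 ?_)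
    · exact le_of_not_gt fun h' => lt_irrefl _ ((h _).1 h')
    · exact le_of_not_gt fun h' => lt_irrefl _ ((h _).2 h')
  refine ⟨⟨Fin k, inferInstance, fun t => len (e.symm t), fun t => (e.symm t).1,
    Subtype.val_injective.comp e.symm.injective, fun t => hne _ _ (hlen _), fun t δ hδ => ?_⟩, ?_⟩
  · obtain ⟨w, x, γ, hrun, hacc, hγ, hs, h⟩ := hlen (e.symm t)
    -- A nonempty suffix of a settled factor has the same length and the same end, so it is again
    -- settled.
    have habs : γ + δ + ω ^ len (e.symm t) = γ + ω ^ len (e.symm t) := by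
      rw [add_assoc, add_omega0_pow hδ]
    have : seg (e.symm t).1 δ (len (e.symm t)) ∈ settledFactors M (ω ^ n) (len (e.symm t)) := by
      refine ⟨w, x, γ + δ, hrun, hacc, habs.trans_le hγ, fun hm ε hε => ?_, ?_⟩
      · rw [habs, add_assoc]
        exact hs hm _ (add_lt_omega0_pow hδ hε)
      · rw [h, seg_seg (add_omega0_pow hδ).le]
    exact ⟨e ⟨_, (hmem _).2 ⟨_, this⟩⟩, by simp⟩
  · rintro w ⟨x, hrun, hacc⟩ i hi hi0
    obtain ⟨a, m, -, rfl⟩ := exists_eq_add_omega0_pow hi0 hi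
    obtain ⟨γ, hγ, hs⟩ : ∃ γ, γ + ω ^ m = a + ω ^ m ∧ (m ≠ 0 → Settled x γ (ω ^ m)) := by
      rcases eq_or_ne m 0 with rfl | hm
      · exact ⟨a, rfl, fun h => absurd rfl h⟩
      · obtain ⟨γ, hγ, hs⟩ := exists_settled x a hm
        exact ⟨γ, hγ, fun _ => hs⟩
    have hf : seg (Word.ext w) γ m ∈ settledFactors M (ω ^ n) m :=
      ⟨w, x, γ, hrun, hacc, hγ.trans_le hi, hs, rfl⟩
    have hfT := (hmem _).2 ⟨m, hf⟩
    refine ⟨γ, e ⟨_, hfT⟩, ?_, ?_⟩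
    · simp only [Equiv.symm_apply_apply]
      rw [hlen_eq ⟨_, hfT⟩ m hf, hγ]
    · simp only [Equiv.symm_apply_apply]
      rw [hlen_eq ⟨_, hfT⟩ m hf]

end Factors

/-! ### Labellings: existence, uniqueness and recovery from the code -/

section Labellings

variable {A : Type} {u u' : Ordinal.{0} → Option A}

namespace FactorSystem

variable (S : FactorSystem A)

attribute [instance] FactorSystem.finite

/-- The concatenation of the words `r` and `t` is a word of the system. -/
def Merge (r t : S.K) : Prop :=
  ∃ s, S.len s = S.len t ∧ S.len r < S.len t ∧ seg (S.word s) 0 (S.len r) = S.word r ∧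
    seg (S.word s) (ω ^ S.len r) (S.len t) = S.word t

/-- The transitions between labels over a distance `ω ^ k`. A label `some (t, b)` at a position
means that the word `t` occurs there, up to the next cut, and `b` tells whether the position is
a cut. The label `none` marks the end. -/
def Next (k : ℕ) (t : S.K) (s : Option (S.K × Bool)) : Prop :=
  (k = S.len t ∧ (s = none ∨ ∃ t', s = some (t', true) ∧ ¬ S.Merge t t')) ∨
    (k < S.len t ∧ ∃ t', s = some (t', false) ∧ S.word t' = seg (S.word t) (ω ^ k) (S.len t))

variable {S} in
/-- Labels of cuts, and of the end. -/
def IsCut (s : Option (S.K × Bool)) : Prop :=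
  s = none ∨ ∃ t, s = some (t, true)

/-- `x` labels the positions up to `l` according to a factorization of `u` into words of the
system, in which no word can be extended to the left within the system. -/
structure IsLabelling (u : Ordinal.{0} → Option A) (x : Ordinal.{0} → Option (S.K × Bool))
    (l : Ordinal.{0}) : Prop where
  zero : IsCut (x 0)
  top : x l = none
  step : ∀ i < l, ∃ t b, x i = some (t, b) ∧ S.word t 0 = u i ∧ S.Next 0 t (x (i + 1))
  lim : ∀ a m, m ≠ 0 → a + ω ^ m ≤ l → ∃ t b, some (t, b) ∈ cofinalStates x (a + ω ^ m) ∧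
    S.Next m t (x (a + ω ^ m))

variable {S}

theorem seg_word_zero (t : S.K) : seg (S.word t) 0 (S.len t) = S.word t := by
  funext δ
  rcases lt_or_ge δ (ω ^ S.len t) with hδ | hδ
  · rw [seg_of_lt hδ, zero_add]
  · rw [seg_of_ge hδ]
    by_contra h
    exact absurd ((S.ne_none_iff t δ).1 (Ne.symm h)) (not_lt.2 hδ)

theorem len_eq_of_word_eq {t t' : S.K} {δ : Ordinal.{0}} (hδ : δ < ω ^ S.len t)
    (h : S.word t' = seg (S.word t) δ (S.len t)) : S.len t' = S.len t := by
  have h' : ∀ ε, ε < ω ^ S.len t' ↔ ε < ω ^ S.len t := by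
    intro ε
    rw [← S.ne_none_iff, h]
    rcases lt_or_ge ε (ω ^ S.len t) with hε | hε
    · rw [seg_of_lt hε, S.ne_none_iff]
      exact iff_of_true (add_lt_omega0_pow hδ hε) hε
    · simp [seg_of_ge hε, hε]
  refine le_antisymm (omega0_pow_le_iff.1 ?_) (omega0_pow_le_iff.1 ?_)
  · exact le_of_not_gt fun h => lt_irrefl _ ((h' _).1 h)
  · exact le_of_not_gt fun h => lt_irrefl _ ((h' _).2 h)

theorem Next.eq_len_of_isCut {k : ℕ} {t : S.K} {s : Option (S.K × Bool)} (h : S.Next k t s)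
    (hs : IsCut s) : k = S.len t := by
  rcases h with ⟨h, -⟩ | ⟨-, t', rfl, -⟩
  · exact h
  · rcases hs with h | ⟨_, h⟩ <;> simp at h

theorem Next.of_false {k : ℕ} {t t' : S.K} (h : S.Next k t (some (t', false))) :
    k < S.len t ∧ S.word t' = seg (S.word t) (ω ^ k) (S.len t) := by
  rcases h with ⟨-, h | ⟨_, h, -⟩⟩ | ⟨hk, t'', h, hw⟩
  · cases h
  · simp at h
  · obtain rfl : t' = t'' := by simpa using h
    exact ⟨hk, hw⟩

theorem Next.not_merge {k : ℕ} {t t' : S.K} (h : S.Next k t (some (t', true))) :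
    k = S.len t ∧ ¬ S.Merge t t' := by
  rcases h with ⟨hk, h | ⟨t'', h, hm⟩⟩ | ⟨-, _, h, -⟩
  · cases h
  · obtain rfl : t' = t'' := by simpa using h
    exact ⟨hk, hm⟩
  · simp at h

namespace IsLabelling

variable {x x' : Ordinal.{0} → Option (S.K × Bool)} {l i ν γ : Ordinal.{0}} {n : ℕ}

/-- Every ν in [a, a + ω^m) satisfies ν + ω^m = a + ω^m, so a recurring label supplies a position as
late as desired from which one step of length ω^m leads to `i`. This treats successors and limits
alike. -/
theorem exists_next (h : S.IsLabelling u x l) (hl : l ≤ ω ^ n) (hi : i ≤ l)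
    {μ : Ordinal.{0}} (hμ : μ < i) :
    ∃ ν k t b, μ ≤ ν ∧ ν < i ∧ ν + ω ^ k = i ∧ x ν = some (t, b) ∧ S.Next k t (x i) := by
  obtain ⟨a, m, -, rfl⟩ := exists_eq_add_omega0_pow (pos_of_gt hμ).ne' (hi.trans hl)
  rcases eq_or_ne m 0 with rfl | hm
  · rw [pow_zero] at hi hμ ⊢
    obtain ⟨t, b, h1, -, h2⟩ := h.step a ((lt_add_one a).trans_le hi)
    exact ⟨a, 0, t, b, Order.le_of_lt_add_one hμ, lt_add_one a, by simp, h1, h2⟩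
  · obtain ⟨t, b, h1, h2⟩ := h.lim a m hm hi
    obtain ⟨ν, hν, hμν, hx⟩ := h1 _ (max_lt hμ (lt_add_omega0_pow a m))
    rw [max_lt_iff] at hμν
    exact ⟨ν, m, t, b, hμν.1.le, hν, add_omega0_pow_eq_of_le_of_lt hμν.2.le hν, hx, h2⟩

/-- Induction on δ along `exists_next`: a step ω^k ending strictly inside the word has k below its
exponent, so `Next` can only pass on the corresponding suffix, marked as no cut. -/
theorem exists_tail (h : S.IsLabelling u x l) (hl : l ≤ ω ^ n) {t : S.K} {b : Bool}
    (hx : x ν = some (t, b)) (δ : Ordinal.{0}) : δ < ω ^ S.len t → ν + δ ≤ l →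
    ∃ t' b', x (ν + δ) = some (t', b') ∧ S.word t' = seg (S.word t) δ (S.len t) ∧
      (δ ≠ 0 → b' = false) := by
  induction δ using WellFoundedLT.induction with
  | ind δ ih =>
  intro hδ hνδ
  rcases eq_or_ne δ 0 with rfl | hδ0
  · exact ⟨t, b, by simpa using hx, (seg_word_zero t).symm, fun h => absurd rfl h⟩
  obtain ⟨ν₁, k, t₁, b₁, hνν₁, hν₁, hk, hx₁, hnext⟩ := h.exists_next hl hνδ
    (lt_add_of_pos_right ν (pos_iff_ne_zero.2 hδ0))
  obtain ⟨δ₁, rfl⟩ := exists_add_of_le hνν₁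
  have hδ₁ : δ₁ < δ := by simpa using hν₁
  obtain ⟨t₁', b₁', hx₁', hw₁, -⟩ := ih δ₁ hδ₁ (hδ₁.trans hδ) (hν₁.le.trans hνδ)
  obtain ⟨rfl, rfl⟩ : t₁ = t₁' ∧ b₁ = b₁' := by simpa [hx₁] using hx₁'
  have hlen := len_eq_of_word_eq (hδ₁.trans hδ) hw₁
  have hkδ : δ₁ + ω ^ k = δ := by simpa [add_assoc] using hk
  have hklt : k < S.len t := omega0_pow_lt_iff.1 (le_add_self.trans_lt (hkδ.trans_lt hδ))
  rcases hnext with ⟨hk', -⟩ | ⟨-, t', hx', hw'⟩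
  · omega
  · refine ⟨t', false, hx', ?_, fun _ => rfl⟩
    rw [hw', hw₁, hlen, seg_seg (add_omega0_pow (omega0_pow_lt_iff.2 hklt)).le, hkδ]

/-- Inside a word the label is never `none`, but at `l` it is. -/
theorem add_len_le (h : S.IsLabelling u x l) (hl : l ≤ ω ^ n) {t : S.K} {b : Bool}
    (hν : ν ≤ l) (hx : x ν = some (t, b)) : ν + ω ^ S.len t ≤ l := by
  by_contra hlt
  obtain ⟨δ, rfl⟩ := exists_add_of_le hν
  obtain ⟨t', b', hx', -⟩ := h.exists_tail hl hx δ (by simpa using hlt) le_rfl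
  simp [h.top] at hx'

/-- `step` checks only the first letter of each remaining suffix; by `exists_tail` these letters
make up the whole word. -/
theorem word_eq (h : S.IsLabelling u x l) (hl : l ≤ ω ^ n) {t : S.K} {b : Bool}
    (hν : ν ≤ l) (hx : x ν = some (t, b)) : S.word t = seg u ν (S.len t) := by
  funext δ
  rcases lt_or_ge δ (ω ^ S.len t) with hδ | hδ
  · have hlt : ν + δ < l := lt_of_lt_of_le (by simpa using hδ) (h.add_len_le hl hν hx)
    obtain ⟨t', b', hx', hw, -⟩ := h.exists_tail hl hx δ hδ hlt.le
    obtain ⟨t'', b'', hx'', hw'', -⟩ := h.step _ hlt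
    obtain ⟨rfl, rfl⟩ : t' = t'' ∧ b' = b'' := by simpa [hx'] using hx''
    rw [seg_of_lt hδ, ← hw'', hw, seg_of_lt (omega0_pow_pos _), add_zero]
  · rw [← seg_word_zero, seg_of_ge hδ, seg_of_ge hδ]

/-- Every cut but the first one is preceded by another cut. -/
theorem exists_cut (h : S.IsLabelling u x l) (hl : l ≤ ω ^ n) (hi0 : i ≠ 0) (hi : i ≤ l)
    (hcut : IsCut (x i)) : ∃ γ t, x γ = some (t, true) ∧ γ + ω ^ S.len t = i := by
  let P : Set Ordinal.{0} := {ν | ∃ t b, x ν = some (t, b) ∧ ν + ω ^ S.len t = i}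
  have hP : P.Nonempty := by
    obtain ⟨ν, k, t, b, -, -, hk, hx, hnext⟩ := h.exists_next hl hi (pos_iff_ne_zero.2 hi0)
    exact ⟨ν, t, b, hx, by rw [← hnext.eq_len_of_isCut hcut, hk]⟩
  obtain ⟨t, b, hx, ht⟩ := csInf_mem hP
  cases b with
  | true => exact ⟨_, t, hx, ht⟩
  | false =>
    exfalso
    -- If the leftmost position whose word ends at `i` were no cut, the word of a predecessor would
    -- end at `i` too.
    have h0 : sInf P ≠ 0 := by
      intro h0
      rw [h0] at hx
      rcases h.zero with h' | ⟨t', h'⟩ <;> simp [hx] at h'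
    have hle : sInf P ≤ l := le_self_add.trans (ht.trans_le hi)
    obtain ⟨ν, k, t₁, b₁, -, hν, hk, hx₁, hnext⟩ :=
      h.exists_next hl hle (pos_iff_ne_zero.2 h0)
    rw [hx] at hnext
    obtain ⟨hlt, hw⟩ := hnext.of_false
    have hlen := len_eq_of_word_eq (omega0_pow_lt_iff.2 hlt) hw
    refine notMem_of_lt_csInf' hν ⟨t₁, b₁, hx₁, ?_⟩
    rw [← ht, ← hk, add_assoc, hlen, add_omega0_pow (omega0_pow_lt_iff.2 hlt)]

/-- The words between cuts cannot be extended to the left. -/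
theorem word_ne_seg (h : S.IsLabelling u x l) (hl : l ≤ ω ^ n) {t t' : S.K} (hγ : γ ≤ l)
    (hx : x γ = some (t, true)) (hνγ : ν < γ) (hν : ν + ω ^ S.len t' = γ + ω ^ S.len t) :
    S.word t' ≠ seg u ν (S.len t') := by
  intro hw
  have hlen := add_omega0_pow_inj hν
  obtain ⟨ν₁, k, t₁, b₁, hνν₁, hν₁γ, hk, hx₁, hnext⟩ := h.exists_next hl hγ hνγ
  rw [hx] at hnext
  obtain ⟨rfl, hmerge⟩ := hnext.not_merge
  have hν₁ : ν₁ + ω ^ S.len t = γ + ω ^ S.len t := by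
    rw [← hν, hlen]
    rw [hlen] at hν
    exact add_omega0_pow_eq_of_le_of_lt hνν₁
      (hν ▸ hν₁γ.trans (lt_add_omega0_pow γ _))
  have hlt : S.len t₁ < S.len t := by
    rw [← omega0_pow_lt_iff, ← add_lt_add_iff_left ν₁, hk, hν₁]
    exact lt_add_omega0_pow γ _
  obtain ⟨δ, rfl⟩ := exists_add_of_le hνν₁
  have hδ : δ < ω ^ S.len t' := by
    have : ν + δ < ν + ω ^ S.len t' := by rw [hν]; exact hν₁γ.trans (lt_add_omega0_pow γ _)
    simpa using this
  -- The suffix of `t'` from ν₁ is in the system and is the concatenation of `t₁` and `t`, contrary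
  -- to the local condition at the cut.
  obtain ⟨t'', ht''⟩ := S.exists_tail t' δ hδ
  have hlen'' := len_eq_of_word_eq hδ ht''
  rw [hw, seg_seg (add_omega0_pow hδ).le, hlen] at ht''
  refine hmerge ⟨t'', hlen''.trans hlen, hlt, ?_, ?_⟩
  · rw [ht'', seg_seg (by simpa using omega0_pow_le_iff.2 hlt.le), add_zero,
      h.word_eq hl (hν₁γ.le.trans hγ) hx₁]
  · rw [ht'', seg_seg (add_omega0_pow (omega0_pow_lt_iff.2 hlt)).le, hk, h.word_eq hl hγ hx]

/-- If the last cuts before `i` differed, the word at the earlier one would extend the other to the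
left, against `word_ne_seg`. So they coincide, with the same word; `exists_tail` settles the
positions after the cut and induction those before it. -/
theorem eq_of_isCut (h : S.IsLabelling u x l) (h' : S.IsLabelling u x' l) (hl : l ≤ ω ^ n)
    (i : Ordinal.{0}) : i ≤ l → IsCut (x i) → IsCut (x' i) → ∀ β < i, x β = x' β := by
  induction i using WellFoundedLT.induction with
  | ind i ih =>
  intro hi hc hc' β hβ
  have hi0 := (pos_of_gt hβ).ne'
  obtain ⟨γ, t, hx, ht⟩ := h.exists_cut hl hi0 hi hc
  obtain ⟨γ', t', hx', ht'⟩ := h'.exists_cut hl hi0 hi hc'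
  have hγi : γ < i := ht ▸ lt_add_omega0_pow γ _
  have hγi' : γ' < i := ht' ▸ lt_add_omega0_pow γ' _
  have hγl := hγi.le.trans hi
  have hγl' := hγi'.le.trans hi
  obtain rfl : γ = γ' := by
    rcases lt_trichotomy γ γ' with hlt | heq | hlt
    · exact absurd (h.word_eq hl hγl hx) (h'.word_ne_seg hl hγl' hx' hlt (ht.trans ht'.symm))
    · exact heq
    · exact absurd (h'.word_eq hl hγl' hx') (h.word_ne_seg hl hγl hx hlt (ht'.trans ht.symm))
  have hlen := add_omega0_pow_inj (ht.trans ht'.symm)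
  obtain rfl : t = t' := S.injective (by rw [h.word_eq hl hγl hx, h'.word_eq hl hγl hx', hlen])
  rcases lt_or_ge β γ with hβγ | hβγ
  · exact ih γ hγi hγl (Or.inr ⟨t, hx⟩) (Or.inr ⟨t, hx'⟩) β hβγ
  · obtain ⟨δ, rfl⟩ := exists_add_of_le hβγ
    rcases eq_or_ne δ 0 with rfl | hδ
    · rw [add_zero, hx, hx']
    have hδt : δ < ω ^ S.len t := by simpa [← ht] using hβ
    obtain ⟨s, b, hs, hw, hb⟩ := h.exists_tail hl hx δ hδt (hβ.le.trans hi)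
    obtain ⟨s', b', hs', hw', hb'⟩ := h'.exists_tail hl hx' δ hδt (hβ.le.trans hi)
    rw [hs, hs', hb hδ, hb' hδ, S.injective (hw.trans hw'.symm)]

/-- The labelling is determined by the word. -/
theorem unique (h : S.IsLabelling u x l) (h' : S.IsLabelling u x' l) (hl : l ≤ ω ^ n) :
    ∀ β < l, x β = x' β :=
  h.eq_of_isCut h' hl l le_rfl (Or.inl h.top) (Or.inl h'.top)

end IsLabelling

/-- The letter of the code at a position with label `s`: the word that starts there if the
position is a cut. -/
def codeLetter (s : Option (S.K × Bool)) : Option S.K :=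
  s.bind fun p => if p.2 then some p.1 else none

namespace IsLabelling

variable {x x' : Ordinal.{0} → Option (S.K × Bool)} {l i ν γ : Ordinal.{0}} {n : ℕ}

/-- The labelling is determined by the code. -/
theorem eq_of_codeLetter_eq (h : S.IsLabelling u x l) (h' : S.IsLabelling u' x' l)
    (hl : l ≤ ω ^ n) (hc : ∀ β < l, codeLetter (x β) = codeLetter (x' β)) (β : Ordinal.{0}) :
    β < l → x β = x' β := by
  induction β using WellFoundedLT.induction with
  | ind β ih =>
  intro hβ
  obtain ⟨t, b, hx, -⟩ := h.step β hβ
  obtain ⟨t', b', hx', -⟩ := h'.step β hβ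
  have hcβ := hc β hβ
  rcases b with _ | _ <;> rcases b' with _ | _ <;> simp [hx, hx', codeLetter] at hcβ
  -- A label that is no cut is passed on from an earlier position, where both labellings agree by
  -- induction.
  · have h0 : β ≠ 0 := by
      rintro rfl
      rcases h.zero with h0 | ⟨t', h0⟩ <;> simp [hx] at h0
    obtain ⟨ν, k, t₁, b₁, -, hν, rfl, hx₁, hnext⟩ :=
      h.exists_next hl hβ.le (pos_iff_ne_zero.2 h0)
    rw [hx] at hnext
    obtain ⟨hlt, hw⟩ := hnext.of_false
    have hx₁' := (ih ν hν (hν.trans hβ)).symm.trans hx₁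
    obtain ⟨t₂, b₂, hx₂, hw₂, hb₂⟩ :=
      h'.exists_tail hl hx₁' (ω ^ k) (omega0_pow_lt_iff.2 hlt) hβ.le
    rw [hx, hx₂, hb₂ (omega0_pow_pos k).ne', S.injective (hw.trans hw₂.symm)]
  · rw [hx, hx', hcβ]

theorem word_eq_of_codeLetter_eq (h : S.IsLabelling u x l) (h' : S.IsLabelling u' x' l)
    (hl : l ≤ ω ^ n) (hc : ∀ β < l, codeLetter (x β) = codeLetter (x' β)) {β : Ordinal.{0}}
    (hβ : β < l) : u β = u' β := by
  obtain ⟨t, b, hx, hu, -⟩ := h.step β hβ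
  obtain ⟨t', b', hx', hu', -⟩ := h'.step β hβ
  have := h.eq_of_codeLetter_eq h' hl hc β hβ
  rw [hx, hx'] at this
  obtain ⟨rfl, rfl⟩ : t = t' ∧ b = b' := by simpa using this
  rw [← hu, hu']

end IsLabelling

/-- Covered words have labellings, with finitely many cuts. -/
theorem exists_isLabelling (S : FactorSystem A) {n : ℕ} (hS : S.Covers u (ω ^ n))
    (i : Ordinal.{0}) : i ≤ ω ^ n → ∃ x, S.IsLabelling u x i ∧
      {β | β < i ∧ ∃ t, x β = some (t, true)}.Finite := by
  induction i using WellFoundedLT.induction with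
  | ind i ih =>
  intro hi
  rcases eq_or_ne i 0 with rfl | hi0
  · refine ⟨fun _ => none, ⟨Or.inl rfl, rfl, fun i hi => absurd hi not_lt_zero,
      fun a m hm h => ?_⟩, by simp⟩
    exact absurd ((lt_add_omega0_pow a m).trans_le h) not_lt_zero
  -- The last block starts at the leftmost possible position; the rest is labelled by induction,
  -- adding one cut at each stage.
  let P : Set Ordinal.{0} := {γ | ∃ t, γ + ω ^ S.len t = i ∧ S.word t = seg u γ (S.len t)}
  have hP : P.Nonempty := by
    obtain ⟨γ, t, h⟩ := hS i hi hi0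
    exact ⟨γ, t, h⟩
  obtain ⟨t, ht, hw⟩ := csInf_mem hP
  have hmin : ∀ ν < sInf P, ν ∉ P := fun ν hν => notMem_of_lt_csInf' hν
  set γ := sInf P
  have hγi : γ < i := ht ▸ lt_add_omega0_pow γ _
  obtain ⟨x₀, h₀, hfin⟩ := ih γ hγi (hγi.le.trans hi)
  have htail : ∀ δ, ∃ t', δ < ω ^ S.len t → S.word t' = seg (S.word t) δ (S.len t) := by
    intro δ
    by_cases hδ : δ < ω ^ S.len t
    · obtain ⟨t', h⟩ := S.exists_tail t δ hδ
      exact ⟨t', fun _ => h⟩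
    · exact ⟨t, fun h => absurd h hδ⟩
  choose T hT using htail
  have hT0 : T 0 = t := S.injective ((hT 0 (omega0_pow_pos _)).trans (seg_word_zero t))
  classical
  let x : Ordinal.{0} → Option (S.K × Bool) := fun β =>
    if β < γ then x₀ β else if β < i then some (T (β - γ), decide (β = γ)) else none
  have hx_lt : ∀ β < γ, x β = x₀ β := fun β hβ => if_pos hβ
  have hx_mid : ∀ δ < ω ^ S.len t, x (γ + δ) = some (T δ, decide (δ = 0)) := by
    intro δ hδ
    have h1 : γ + δ < i := by rw [← ht]; simpa using hδ
    simp only [x]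
    rw [if_neg (not_lt.2 le_self_add), if_pos h1, add_sub_cancel]
    simp
  have hx_top : x i = none := by simp [x, hγi.le]
  have hxγ : x γ = some (t, true) := by simpa [hT0] using hx_mid 0 (omega0_pow_pos _)
  -- At γ the end mark of `x₀` becomes a cut. A merge across it would be a word of the system ending
  -- at `i` and starting left of γ, against minimality.
  have hA : ∀ ν k t₁ b, ν + ω ^ k = γ → x₀ ν = some (t₁, b) → S.Next k t₁ (x₀ γ) →
      S.Next k t₁ (x γ) := by
    intro ν k t₁ b hν hxν hnext
    have hνγ : ν < γ := hν ▸ lt_add_omega0_pow ν k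
    obtain rfl := hnext.eq_len_of_isCut (Or.inl h₀.top)
    refine Or.inl ⟨rfl, Or.inr ⟨t, hxγ, ?_⟩⟩
    rintro ⟨t'', hlen, hlt, h1, h2⟩
    refine hmin ν hνγ ⟨t'', ?_, ?_⟩
    · rw [hlen, ← ht, ← hν, add_assoc, add_omega0_pow (omega0_pow_lt_iff.2 hlt)]
    · have hw₁ := h₀.word_eq (hγi.le.trans hi) hνγ.le hxν
      funext δ
      rcases lt_or_ge δ (ω ^ S.len t'') with hδ | hδ
      · rw [seg_of_lt hδ]
        rcases lt_or_ge δ (ω ^ S.len t₁) with hδ₁ | hδ₁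
        · rw [← zero_add δ, ← seg_of_lt (u := S.word t'') hδ₁, h1, hw₁, seg_of_lt hδ₁, zero_add]
        · obtain ⟨ε, rfl⟩ := exists_add_of_le hδ₁
          have hε : ε < ω ^ S.len t := hlen ▸ le_add_self.trans_lt hδ
          rw [← seg_of_lt (u := S.word t'') hε, h2, hw, seg_of_lt hε, ← hν, add_assoc]
      · rw [← seg_word_zero, seg_of_ge hδ, seg_of_ge hδ]
  have hB : ∀ δ < ω ^ S.len t, ∀ k, γ + δ + ω ^ k ≤ i → S.Next k (T δ) (x (γ + δ + ω ^ k)) := by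
    intro δ hδ k hk
    have hlen := len_eq_of_word_eq hδ (hT δ hδ)
    have hδi : γ + δ + ω ^ S.len t = i := by rw [add_assoc, add_omega0_pow hδ, ht]
    have hkle : k ≤ S.len t := by
      rw [← omega0_pow_le_iff, ← add_le_add_iff_left (γ + δ), hδi]
      exact hk
    rcases hkle.lt_or_eq with hklt | rfl
    · have hδk := add_lt_omega0_pow hδ (omega0_pow_lt_iff.2 hklt)
      refine Or.inr ⟨hlen ▸ hklt, T (δ + ω ^ k), ?_, ?_⟩
      · rw [add_assoc, hx_mid _ hδk]
        simp [(omega0_pow_pos k).ne']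
      · rw [hT _ hδk, hlen, hT δ hδ, seg_seg (add_omega0_pow (omega0_pow_lt_iff.2 hklt)).le]
    · exact Or.inl ⟨hlen.symm, Or.inl (by rw [hδi, hx_top])⟩
  refine ⟨x, ⟨?_, hx_top, fun j hj => ?_, fun a m hm ham => ?_⟩, ?_⟩
  · rcases eq_or_ne γ 0 with h0 | h0
    · exact Or.inr ⟨t, h0 ▸ hxγ⟩
    · rw [hx_lt 0 (pos_iff_ne_zero.2 h0)]
      exact h₀.zero
  · rcases lt_or_ge j γ with hjγ | hjγ
    · obtain ⟨t₁, b, h1, h2, h3⟩ := h₀.step j hjγ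
      refine ⟨t₁, b, by rw [hx_lt j hjγ, h1], h2, ?_⟩
      rcases (Order.add_one_le_of_lt hjγ).lt_or_eq with h4 | h4
      · rw [hx_lt _ h4]; exact h3
      · rw [h4] at h3 ⊢
        exact hA j 0 t₁ b (by simpa using h4) h1 h3
    · obtain ⟨δ, rfl⟩ := exists_add_of_le hjγ
      have hδ : δ < ω ^ S.len t := by simpa [← ht] using hj
      refine ⟨_, _, hx_mid δ hδ, ?_, by simpa using hB δ hδ 0 (by simpa using Order.add_one_le_of_lt hj)⟩
      rw [hT δ hδ, seg_of_lt (omega0_pow_pos _), hw, add_zero, seg_of_lt hδ]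
  · have hl := isSuccLimit_add_omega0_pow a hm
    rcases le_or_gt (a + ω ^ m) γ with h1 | h1
    · obtain ⟨t₁, b, hmem, hnext⟩ := h₀.lim a m hm h1
      have hcof : cofinalStates x (a + ω ^ m) = cofinalStates x₀ (a + ω ^ m) :=
        cofinalStates_congr' hl a (lt_add_omega0_pow a m) fun δ _ hδ => hx_lt δ (hδ.trans_le h1)
      refine ⟨t₁, b, hcof ▸ hmem, ?_⟩
      rcases h1.lt_or_eq with h2 | h2
      · rw [hx_lt _ h2]; exact hnext
      · obtain ⟨ν, hν, haν, hxν⟩ := hmem a (lt_add_omega0_pow a m)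
        have hνγ := (add_omega0_pow_eq_of_le_of_lt haν.le hν).trans h2
        rw [h2] at hnext ⊢
        exact hA ν m t₁ b hνγ hxν hnext
    -- Beyond γ, any recurring label will do, read at an occurrence past both a and γ, so that `hB`
    -- applies.
    · obtain ⟨ν, hν, hlt, hmem⟩ := exists_mem_cofinalStates x hl
        (max_lt (lt_add_omega0_pow a m) h1)
      rw [max_lt_iff] at hlt
      have hνm := add_omega0_pow_eq_of_le_of_lt hlt.1.le hν
      obtain ⟨δ, rfl⟩ := exists_add_of_le hlt.2.le
      have hδ : δ < ω ^ S.len t := by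
        have := hν.trans_le ham
        rw [← ht] at this
        simpa using this
      rw [hx_mid δ hδ] at hmem
      refine ⟨_, _, hmem, ?_⟩
      rw [← hνm] at ham ⊢
      exact hB δ hδ m ham
  · refine (hfin.insert γ).subset ?_
    rintro β ⟨hβ, t', hxt⟩
    rcases lt_or_ge β γ with hβγ | hβγ
    · exact Or.inr ⟨hβγ, t', by rw [← hx_lt β hβγ, hxt]⟩
    · left
      obtain ⟨δ, rfl⟩ := exists_add_of_le hβγ
      rw [hx_mid δ (by simpa [← ht] using hβ)] at hxt
      have : δ = 0 := by simpa using (Prod.mk.inj (Option.some.inj hxt)).2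
      simp [this]

end FactorSystem

end Labellings

/-! ### The coding by finite words and the transfer of structures -/

section Coding

variable {A : Type} {n : ℕ}

theorem FactorSystem.isRegular_code (S : FactorSystem A) (n : ℕ) :
    IsRegular {z : Word (ω ^ n) (A × Option S.K) | ∃ x,
      S.IsLabelling (Word.ext fun i => (z i).1) x (ω ^ n) ∧
        ∀ i : Set.Iio ((ω : Ordinal.{0}) ^ n), (z i).2 = codeLetter (x i)} := by
  have h := isRegular_of_ranked (A := A × Option S.K) (Q := Option (S.K × Bool)) n
    {s | IsCut s}
    {p | ∃ t b, p.1 = some (t, b) ∧ S.word t 0 = some p.2.1.1 ∧ S.Next 0 t p.2.2 ∧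
      p.2.1.2 = codeLetter p.1}
    (fun m P s => ∃ t b, some (t, b) ∈ P ∧ S.Next m t s) {none}
  convert h using 1
  ext z
  constructor
  · rintro ⟨x, hx, hc⟩
    refine ⟨x, hx.zero, fun i => ?_, hx.lim, hx.top⟩
    obtain ⟨t, b, h1, h2, h3⟩ := hx.step i i.2
    rw [Word.ext_of_lt _ (Set.mem_Iio.1 i.2)] at h2
    exact ⟨t, b, h1, h2, h3, hc i⟩
  · rintro ⟨x, h0, hs, hl, ht⟩
    refine ⟨x, ⟨h0, ht, fun i hi => ?_, hl⟩, fun i => ?_⟩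
    · obtain ⟨t, b, h1, h2, h3, -⟩ := hs ⟨i, hi⟩
      rw [Word.ext_of_lt _ hi]
      exact ⟨t, b, h1, h2, h3⟩
    · obtain ⟨t, b, -, -, -, h⟩ := hs i
      exact h

/-- Countable regular languages of words of length `ω ^ n` can be represented by finite words. -/
theorem IsRegular.isRepresentableByFiniteWords [Finite A] {L : Set (Word (ω ^ n) A)}
    (hL : L.Countable) (hreg : IsRegular L) : IsRepresentableByFiniteWords L := by
  have hreg' := hreg
  obtain ⟨Q, _, M, rfl⟩ := hreg
  obtain ⟨S, hS⟩ := exists_factorSystem hL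
  have hex : ∀ w : Word (ω ^ n) A, ∃ x, w ∈ M.language (ω ^ n) →
      S.IsLabelling w.ext x (ω ^ n) ∧ {β | β < ω ^ n ∧ ∃ t, x β = some (t, true)}.Finite := by
    intro w
    by_cases hw : w ∈ M.language (ω ^ n)
    · obtain ⟨x, hx⟩ := S.exists_isLabelling (hS w hw) _ le_rfl
      exact ⟨x, fun _ => hx⟩
    · exact ⟨fun _ => none, fun h => absurd h hw⟩
  choose X hX using hex
  let f : Word (ω ^ n) A → Word (ω ^ n) (Option S.K) := fun w i =>
    FactorSystem.codeLetter (X w i)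
  -- `X` is chosen arbitrarily, but uniqueness of labellings identifies the graph with the set of
  -- pairs for which some labelling exists.
  have hgraph : IsRegular ((fun w => pairWord w (f w)) '' M.language (ω ^ n)) := by
    have h := (hreg'.preimage (Prod.fst : A × Option S.K → A)).inter (S.isRegular_code n)
    convert h using 1
    ext z
    constructor
    · rintro ⟨w, hw, rfl⟩
      exact ⟨hw, X w, (hX w hw).1, fun _ => rfl⟩
    · rintro ⟨hw, x, hx, hc⟩
      refine ⟨_, hw, funext fun i => Prod.ext rfl ?_⟩
      rw [hc i, ← (hX _ hw).1.unique hx le_rfl i i.2]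
      rfl
  refine ⟨Option S.K, inferInstance, none, f, ?_, ?_, ?_, hgraph⟩
  · intro w hw w' hw' hww
    funext i
    have := (hX w hw).1.word_eq_of_codeLetter_eq (hX w' hw').1 le_rfl
      (fun β hβ => congrFun hww ⟨β, hβ⟩) i.2
    rw [w.ext_of_lt (Set.mem_Iio.1 i.2), w'.ext_of_lt (Set.mem_Iio.1 i.2)] at this
    exact Option.some.inj this
  · intro w hw
    refine Set.Finite.of_finite_image ((hX w hw).2.subset ?_) Subtype.val_injective.injOn
    rintro _ ⟨i, hi, rfl⟩
    refine ⟨i.2, ?_⟩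
    obtain ⟨t, b, hx, -⟩ := (hX w hw).1.step i i.2
    refine ⟨t, ?_⟩
    cases b with
    | true => exact hx
    | false =>
      refine absurd ?_ hi
      change FactorSystem.codeLetter (X w i) = none
      rw [hx]
      rfl
  · have h := hgraph.image (Prod.snd : A × Option S.K → Option S.K)
    rwa [Set.image_image] at h

/-- An injective presentation of a structure can be transferred along a coding of its domain by
finite words. -/
theorem IsInjectivePresentation.isFiniteWordAutomatic {D : Type u} {S : RelStructure D}
    {α : Ordinal.{0}} {L : Set (Word α A)}
    {R : (i : Fin S.num) → Set (Word α (Fin (S.arity i) → A))} {h : L ≃ D}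
    (hp : IsInjectivePresentation S α A L R h) (hL : IsRepresentableByFiniteWords L) :
    IsFiniteWordAutomatic α S := by
  obtain ⟨B, _, d, f, hinj, hfin, hreg, hgraph⟩ := hL
  let e : L ≃ f '' L := Equiv.Set.imageOfInjOn f L hinj
  let R' : (i : Fin S.num) → Set (Word α (Fin (S.arity i) → B)) := fun i =>
    {z | ∃ y : Fin (S.arity i) → L, (tupleWord fun j => (y j : Word α A)) ∈ R i ∧
      z = tupleWord fun j => f (y j)}
  refine ⟨B, ‹_›, d, f '' L, R', e.symm.trans h, ⟨hreg, fun i => ?_, ?_, ?_⟩, ?_⟩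
  · have h1 := (hp.regular_rel i).preimage
      (fun (c : Fin (S.arity i) → A × B) j => (c j).1)
    have h2 := IsRegular.iInter fun j : Fin (S.arity i) =>
      hgraph.preimage (fun c : Fin (S.arity i) → A × B => c j)
    -- Guess the original words, check the relation on them and the graph of the coding in every
    -- coordinate, then project to the codes.
    have h3 := (h1.inter h2).image (fun (c : Fin (S.arity i) → A × B) j => (c j).2)
    convert h3 using 1
    ext z
    constructor
    · rintro ⟨y, hy, rfl⟩
      refine ⟨fun β j => ((y j : Word α A) β, f (y j) β), ⟨hy, Set.mem_iInter.2 fun j => ?_⟩, rfl⟩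
      exact ⟨y j, (y j).2, rfl⟩
    · rintro ⟨c, ⟨hc, hc'⟩, rfl⟩
      rw [Set.mem_iInter] at hc'
      choose y hy hyc using hc'
      have hyc' : ∀ j β, c β j = (y j β, f (y j) β) := fun j β => (congrFun (hyc j) β).symm
      refine ⟨fun j => ⟨y j, hy j⟩, ?_, ?_⟩
      · have hc : (fun β j => (c β j).1) ∈ R i := hc
        simp only [hyc'] at hc
        exact hc
      · funext β j
        simp [tupleWord, hyc']
  · rintro i w ⟨y, -, rfl⟩
    exact ⟨fun j => e (y j), rfl⟩
  · intro i y
    obtain ⟨y, rfl⟩ : ∃ y' : Fin (S.arity i) → L, y = fun j => e (y' j) :=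
      ⟨fun j => e.symm (y j), by simp⟩
    simp only [Equiv.trans_apply, Equiv.symm_apply_apply, ← hp.map_rel]
    constructor
    · rintro ⟨y', hy', heq⟩
      have : y = y' := by
        funext j
        refine Subtype.ext (hinj (y j).2 (y' j).2 ?_)
        funext β
        exact congrFun (congrFun heq β) j
      rwa [this]
    · exact fun hy => ⟨y, hy, rfl⟩
  · rintro _ ⟨w, hw, rfl⟩
    exact hfin w hw

end Coding

/-- Countable injectively `ω ^ n`-automatic structures are finite-word `ω ^ n`-automatic. -/
theorem IsInjectivelyAutomatic.isFiniteWordAutomatic {D : Type u} [Countable D]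
    {S : RelStructure D} {n : ℕ} (h : IsInjectivelyAutomatic (ω ^ n) S) :
    IsFiniteWordAutomatic (ω ^ n) S := by
  obtain ⟨A, _, L, R, e, hp⟩ := h
  have : Countable L := e.injective.countable
  exact hp.isFiniteWordAutomatic
    (hp.regular_domain.isRepresentableByFiniteWords (Set.countable_coe_iff.1 this))

end OrdAut

theorem proposition4p6 (n : ℕ) (hn : 1 ≤ n) :
    (∀ δ : Ordinal.{v}, δ.card ≤ Cardinal.aleph0 →
      OrdAut.IsInjectivelyAutomatic (ω ^ n) (OrdAut.ordinalStructure δ) →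
      OrdAut.IsFiniteWordAutomatic (ω ^ n) (OrdAut.ordinalStructure δ)) ∧
    (∀ (A : Type) [Finite A] (L : Set (OrdAut.Word (ω ^ n) A)),
      L.Countable → OrdAut.IsRegular L → OrdAut.IsRepresentableByFiniteWords L) := by
  refine ⟨fun δ hδ h => ?_, fun A _ L hL hreg => hreg.isRepresentableByFiniteWords hL⟩
  have : Countable (Set.Iio δ) := by
    rw [← Cardinal.mk_le_aleph0_iff, Cardinal.mk_Iio_ordinal]
    exact Cardinal.lift_le_aleph0.2 hδ
  exact h.isFiniteWordAutomatic
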